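/- Let $\mathbb R^4_1$ be Lorentz–Minkowski space with metric $\langle x,y\rangle=-x_0y_0+x_1y_1+x_2y_2+x_3y_3$, let $H^3=\{\langle x,x\rangle=-1,\ x_0>0\}$ and $S^3_1=\{\langle x,x\rangle=1\}$, and let $M^2$ be a connected smooth $2$-manifold. A smooth map $f:M^2\to H^3$ is a front if near each point there is a smooth unit normal field $\nu$, that is, a smooth map into $S^3_1$ with $\langle f,\nu\rangle=0$ and $\langle df,\nu\rangle=0$, such that $(f,\nu)$ is an immersion; put $f_\delta=(\cosh\delta)f+(\sinh\delta)\nu$ and $\nu_\delta=(\cosh\delta)\nu+(\sinh\delta)f$. For an immersion with unit normal field $\nu$ let $H$ be the mean curvature (with second fundamental form $-\langle df,d\nu\rangle$) and $K$ the Gaussian curvature. A front $f$ is a horospherical linear Weingarten front if it has at least one regular point and if near each point there are a unit normal field $\nu$ and $\delta_0\in\mathbb R$ such that $f_{\delta_0}$ is an immersion with $a(H-1)+bK=0$ for some real $(a,b)\neq(0,0)$. For $\varepsilon\in\mathbb R$, $W_\varepsilon(M^2)$ is the set of horospherical linear Weingarten fronts $f:M^2\to H^3$ which near each point have a unit normal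 field with respect to which $2\varepsilon(H-1)+(1-\varepsilon)K=0$ at all regular points. Let $\varepsilon<0$ and $f\in W_\varepsilon(M^2)$, and suppose that $f(M^2)$ is not contained in a totally geodesic plane or in an equidistant surface of one (that is, $\langle f,v\rangle$ is not constant for any $v$ with $\langle v,v\rangle>0$). Then $f$ has a unit normal field $\nu$ defined on all of $M^2$ such that $2\varepsilon(H-1)+(1-\varepsilon)K=0$ with respect to $\nu$ at every regular point of $f$. For every such $\nu$ there is a real number $\delta$ such that $\nu_\delta:M^2\to S^3_1$ is a CMC-1 front with unit normal field $f_\delta$ (that is, $(\nu_\delta,f_\delta)$ is an immersion, $\nu_\delta$ has regular points, and at all of them its mean curvature, with respect to $f_\delta$ and the second fundamental form $-\langle d\nu_\delta,df_\delta\rangle$, is $1$), and such that the singular set of $\nu_\delta$ (the points where $d\nu_\delta$ is not injective) consists only of isolated points of $M^2$. If moreover $f(M^2)$ is not contained in a horosphere, then $\delta$ is the unique real number for which $\nu_\delta$ is a CMC-1 front with unit normal field $f_\delta$. -/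

import Mathlib

open scoped Manifold ContDiff Topology

namespace HypFront

/-- The vector space underlying Lorentz-Minkowski 4-space. -/
abbrev R41 : Type := Fin 4 → ℝ

/-- The Lorentz metric of signature `(-,+,+,+)`. -/
def lor (x y : R41) : ℝ := -(x 0 * y 0) + x 1 * y 1 + x 2 * y 2 + x 3 * y 3

/-- Hyperbolic 3-space, as the upper sheet of the hyperboloid. -/
def H3 : Set R41 := {x | lor x x = -1 ∧ 0 < x 0}

/-- De Sitter 3-space. -/
def S31 : Set R41 := {x | lor x x = 1}

noncomputable section

variable {M : Type*} [TopologicalSpace M] [ChartedSpace (EuclideanSpace ℝ (Fin 2)) M]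

/-- The differential of `g : M → R41` at `p`, as a linear map on the tangent plane (which is
identified with the plane through the preferred chart at `p`). -/
def diff (g : M → R41) (p : M) : EuclideanSpace ℝ (Fin 2) →L[ℝ] R41 :=
  mfderiv (𝓡 2) 𝓘(ℝ, R41) g p

/-- `p` is a regular point of `g` if `dg` is injective at `p`; otherwise it is singular. -/
def IsRegularPt (g : M → R41) (p : M) : Prop := Function.Injective (diff g p)

/-- The singular set of `g`. -/
def singularSet (g : M → R41) : Set M := {p | ¬ IsRegularPt g p}

/-- The coordinate basis of the tangent plane. -/
def tbasis (i : Fin 2) : EuclideanSpace ℝ (Fin 2) := EuclideanSpace.single i 1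

/-- Gram matrix of the first fundamental form `I = ⟨dg, dg⟩` at `p`. -/
def firstForm (g : M → R41) (p : M) : Matrix (Fin 2) (Fin 2) ℝ :=
  Matrix.of fun i j => lor (diff g p (tbasis i)) (diff g p (tbasis j))

/-- Gram matrix of the second fundamental form `II = -⟨dg, dn⟩` of `g` with respect to the
normal field `n`, at `p`. -/
def secondForm (g n : M → R41) (p : M) : Matrix (Fin 2) (Fin 2) ℝ :=
  Matrix.of fun i j => -lor (diff g p (tbasis i)) (diff n p (tbasis j))

/-- Mean curvature at a regular point: half the trace of the shape operator `I⁻¹ II`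
(the operator `A` with `dn = - dg ∘ A`). -/
def meanCurv (g n : M → R41) (p : M) : ℝ :=
  ((firstForm g p)⁻¹ * secondForm g n p).trace / 2

/-- Gaussian curvature, at a regular point, of a surface in hyperbolic 3-space: the curvature
`-1` of the ambient space plus the determinant of the shape operator `I⁻¹ II`. -/
def gaussCurv (g n : M → R41) (p : M) : ℝ :=
  -1 + ((firstForm g p)⁻¹ * secondForm g n p).det

/-- For `g` with values in one of the two quadrics `H3`, `S31` and `N` the other one: on the
open set `U`, `n` is a smooth `N`-valued unit normal field of `g`. -/
def IsUnitNormalOn (N : Set R41) (g n : M → R41) (U : Set M) : Prop :=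
  ContMDiffOn (𝓡 2) 𝓘(ℝ, R41) ∞ n U ∧
  ∀ p ∈ U, n p ∈ N ∧ lor (g p) (n p) = 0 ∧ ∀ v, lor (diff g p v) (n p) = 0

/-- The pair `(g, n)` is an immersion at every point of `U`. -/
def PairImmersionOn (g n : M → R41) (U : Set M) : Prop :=
  ∀ p ∈ U, ∀ v, diff g p v = 0 → diff n p v = 0 → v = 0

/-- A front in hyperbolic 3-space, not necessarily co-orientable: a smooth map which locally
has a unit normal field `ν` such that the Legendrian lift `(f, ν)` is an immersion. -/
def IsFrontH3 (f : M → R41) : Prop :=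
  ContMDiff (𝓡 2) 𝓘(ℝ, R41) ∞ f ∧ (∀ p, f p ∈ H3) ∧
  ∀ p, ∃ U : Set M, IsOpen U ∧ p ∈ U ∧
    ∃ ν : M → R41, IsUnitNormalOn S31 f ν U ∧ PairImmersionOn f ν U

/-- `par δ f ν = (cosh δ) f + (sinh δ) ν` is the parallel front `f_δ`, and
`par δ ν f = (cosh δ) ν + (sinh δ) f` is its unit normal field `ν_δ`. -/
def par (δ : ℝ) (f ν : M → R41) : M → R41 :=
  fun p => Real.cosh δ • f p + Real.sinh δ • ν p

/-- On `U`, `f` is a horospherical linear Weingarten immersion, with respect to the unit normal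
field `ν`. -/
def IsHLWImmersionOn (f ν : M → R41) (U : Set M) : Prop :=
  (∀ p ∈ U, IsRegularPt f p) ∧
  ∃ a b : ℝ, a ^ 2 + b ^ 2 ≠ 0 ∧
    ∀ p ∈ U, a * (meanCurv f ν p - 1) + b * gaussCurv f ν p = 0

/-- A horospherical linear Weingarten front: a front with at least one regular point, such that
near each point some parallel front is a horospherical linear Weingarten immersion. -/
def IsHLWFront (f : M → R41) : Prop :=
  IsFrontH3 f ∧ (∃ p, IsRegularPt f p) ∧
  ∀ p, ∃ U : Set M, IsOpen U ∧ p ∈ U ∧ ∃ ν : M → R41, IsUnitNormalOn S31 f ν U ∧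
    ∃ δ₀ : ℝ, IsHLWImmersionOn (par δ₀ f ν) (par δ₀ ν f) U

/-- The relation `2ε(H - 1) + (1 - ε)K = 0` at all regular points of `f` in `U`, with respect to
the normal field `ν`. -/
def SatisfiesLW (ε : ℝ) (f ν : M → R41) (U : Set M) : Prop :=
  ∀ p ∈ U, IsRegularPt f p →
    2 * ε * (meanCurv f ν p - 1) + (1 - ε) * gaussCurv f ν p = 0

variable (M) in
/-- The class `W_ε(M)` for real `ε`: horospherical linear Weingarten fronts which satisfy
`2ε(H - 1) + (1 - ε)K = 0` with respect to suitable local unit normal fields. Global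
co-orientability is not required. -/
def W (ε : ℝ) : Set (M → R41) :=
  {f | IsHLWFront f ∧ ∀ p, ∃ U : Set M, IsOpen U ∧ p ∈ U ∧
    ∃ ν : M → R41, IsUnitNormalOn S31 f ν U ∧ SatisfiesLW ε f ν U}

/-- `g` is a (spacelike, co-oriented) CMC-1 front in de Sitter 3-space, with unit normal field
`n` in hyperbolic 3-space: `(g, n)` is a Legendrian immersion, `g` has regular points, and its
mean curvature is one at all of them. -/
def IsCMC1FrontS31 (g n : M → R41) : Prop :=
  ContMDiff (𝓡 2) 𝓘(ℝ, R41) ∞ g ∧ (∀ p, g p ∈ S31) ∧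
  IsUnitNormalOn H3 g n Set.univ ∧ PairImmersionOn g n Set.univ ∧
  (∃ p, IsRegularPt g p) ∧ ∀ p, IsRegularPt g p → meanCurv g n p = 1

/-- Every point of `S` is an isolated point of `S`. -/
def ConsistsOfIsolatedPoints (S : Set M) : Prop := ∀ p ∈ S, ∀ᶠ q in 𝓝[≠] p, q ∉ S

/-- The image of `f` lies in a totally geodesic plane or in one of its equidistant surfaces:
`⟨f, v⟩` is constant for some spacelike vector `v`. -/
def InEquidistant (f : M → R41) : Prop :=
  ∃ v : R41, 0 < lor v v ∧ ∃ c : ℝ, ∀ p, lor (f p) v = c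

/-- The image of `f` lies in a horosphere: `⟨f, v⟩` is constant for some lightlike vector `v`. -/
def InHorosphere (f : M → R41) : Prop :=
  ∃ v : R41, v ≠ 0 ∧ lor v v = 0 ∧ ∃ c : ℝ, ∀ p, lor (f p) v = c

end

end HypFront

open HypFront

/-! The Gauss map `f + ν` takes values in the light cone, and in terms of the area form of the
tangent planes the relation `2ε(H - 1) + (1 - ε)K = 0` says exactly that the mixed area of
`d(f + ν)` and of `d((1 - ε)ν - (1 + ε)f)` vanishes. This form of the relation makes sense at
singular points of `f`, and is compatible with parallel fronts because `f_δ + ν_δ` is a multiple of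
`f + ν`; if `exp (2δ) = -ε`, the second map is a multiple of `ν_δ`, and the relation says that `ν_δ`
has mean curvature one.

Where `f + ν` is an immersion it induces a conformal structure, for which `dν_δ` is symmetric and
trace-free, and by the Codazzi equation its Hopf differential is holomorphic. At a singular point
`dν_δ` vanishes, so singular points are zeros of a holomorphic function: they are isolated unless
`ν_δ` is constant, and then `f` lies in an equidistant surface. The same identity principle shows
that the regular points of `f` are dense and that local unit normals compatible with the relation
agree up to a sign, which is determined unless `f` lies in a totally geodesic plane. -/

namespace HypFront

noncomputable section

/-! ### Lorentz geometry of the normal planes -/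

section lor

variable (c : ℝ) (x y z : R41)

lemma lor_comm : lor x y = lor y x := by simp only [lor]; ring

@[simp] lemma lor_add_left : lor (x + y) z = lor x z + lor y z := by
  simp only [lor, Pi.add_apply]; ring

@[simp] lemma lor_smul_left : lor (c • x) y = c * lor x y := by
  simp only [lor, Pi.smul_apply, smul_eq_mul]; ring

/-- The Lorentz metric as a continuous bilinear form. -/
def lorForm : R41 →L[ℝ] R41 →L[ℝ] ℝ :=
  (LinearMap.mk₂ ℝ lor lor_add_left lor_smul_left
    (fun x y z => by simp only [lor_comm x, lor_add_left])
    (fun c x y => by simp only [lor_comm x, lor_smul_left, smul_eq_mul])).toContinuousBilinearMap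

@[simp] lemma lorForm_apply : lorForm x y = lor x y := rfl

@[simp] lemma lor_add_right : lor x (y + z) = lor x y + lor x z := map_add (lorForm x) y z

@[simp] lemma lor_smul_right : lor x (c • y) = c * lor x y := map_smul (lorForm x) c y

@[simp] lemma lor_neg_right : lor x (-y) = -lor x y := map_neg (lorForm x) y

@[simp] lemma lor_zero_left : lor 0 x = 0 := by simp [lor]

@[simp] lemma lor_zero_right : lor x 0 = 0 := map_zero (lorForm x)

end lor

/-- Cauchy–Schwarz for the spatial parts of the two vectors. -/
lemma sq_mul_zero_le {x y : R41} (h : lor x y = 0) :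
    (x 0 * y 0) ^ 2 ≤ (lor x x + x 0 ^ 2) * (lor y y + y 0 ^ 2) := by
  simp only [lor] at *
  rw [show x 0 * y 0 = x 1 * y 1 + x 2 * y 2 + x 3 * y 3 by linarith]
  nlinarith [sq_nonneg (x 1 * y 2 - x 2 * y 1), sq_nonneg (x 1 * y 3 - x 3 * y 1),
    sq_nonneg (x 2 * y 3 - x 3 * y 2)]

lemma lor_self_pos {x y : R41} (hx : lor x x = -1) (hxy : lor y x = 0) (hy : y ≠ 0) :
    0 < lor y y := by
  have hC := sq_mul_zero_le hxy
  rw [hx] at hC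
  have hx0 : 1 ≤ x 0 ^ 2 := by
    simp only [lor] at hx
    nlinarith [sq_nonneg (x 1), sq_nonneg (x 2), sq_nonneg (x 3)]
  have hspace : 0 < lor y y + y 0 ^ 2 := by
    by_contra! hle
    simp only [lor] at hle
    have h1 : y 1 = 0 := by nlinarith [sq_nonneg (y 1), sq_nonneg (y 2), sq_nonneg (y 3)]
    have h2 : y 2 = 0 := by nlinarith [sq_nonneg (y 1), sq_nonneg (y 2), sq_nonneg (y 3)]
    have h3 : y 3 = 0 := by nlinarith [sq_nonneg (y 1), sq_nonneg (y 2), sq_nonneg (y 3)]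
    have h0 : y 0 = 0 := by
      simp only [lor, h1, h2, h3] at hxy
      refine (mul_eq_zero.1 (by linarith : y 0 * x 0 = 0)).resolve_right fun h => ?_
      rw [h] at hx0
      norm_num at hx0
    exact hy (funext fun i => by fin_cases i <;> assumption)
  nlinarith

lemma eq_zero_of_lor_self {x y : R41} (hx : lor x x = -1) (hxy : lor y x = 0)
    (hy : lor y y = 0) : y = 0 :=
  by_contra fun h => (lor_self_pos hx hxy h).ne' hy

/-- The signed area of the parallelogram spanned by `a` and `b` in the orthogonal complement of
the orthonormal vectors `x` and `n`. -/
def area (x n a b : R41) : ℝ := (Matrix.of ![x, n, a, b]).det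

section area

variable (x n a b c : R41) (r : ℝ)

lemma area_eq : area x n a b =
    (x 0 * n 1 - x 1 * n 0) * (a 2 * b 3 - a 3 * b 2)
    - (x 0 * n 2 - x 2 * n 0) * (a 1 * b 3 - a 3 * b 1)
    + (x 0 * n 3 - x 3 * n 0) * (a 1 * b 2 - a 2 * b 1)
    + (x 1 * n 2 - x 2 * n 1) * (a 0 * b 3 - a 3 * b 0)
    - (x 1 * n 3 - x 3 * n 1) * (a 0 * b 2 - a 2 * b 0)
    + (x 2 * n 3 - x 3 * n 2) * (a 0 * b 1 - a 1 * b 0) := by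
  simp only [area, Matrix.det_succ_row_zero, Fin.sum_univ_succ]
  simp [Fin.succAbove, Matrix.of_apply]
  ring

lemma area_swap : area x n a b = -area x n b a := by
  simp only [area_eq]; ring

@[simp] lemma area_self : area x n a a = 0 := by
  simp only [area_eq]; ring

@[simp] lemma area_add_left : area x n (a + b) c = area x n a c + area x n b c := by
  simp only [area_eq, Pi.add_apply]; ring

@[simp] lemma area_smul_left : area x n (r • a) b = r * area x n a b := by
  simp only [area_eq, Pi.smul_apply, smul_eq_mul]; ring

@[simp] lemma area_add_right : area x n a (b + c) = area x n a b + area x n a c := by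
  simp only [area_swap x n a, area_add_left]; ring

@[simp] lemma area_smul_right : area x n a (r • b) = r * area x n a b := by
  simp only [area_swap x n a, area_smul_left]; ring

@[simp] lemma area_zero_left : area x n 0 a = 0 := by simp [area_eq]

@[simp] lemma area_zero_right : area x n a 0 = 0 := by simp [area_eq]

lemma area_neg_normal : area x (-n) a b = -area x n a b := by
  simp only [area_eq, Pi.neg_apply]; ring

end area

/-- A timelike unit vector `x` and a spacelike unit vector `n` orthogonal to it: a point of the
hyperboloid together with a unit normal. -/
structure NormalFrame (x n : R41) : Prop where
  lor_self : lor x x = -1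
  lor_self_normal : lor n n = 1
  lor_normal : lor x n = 0

/-- The orthogonal complement of `x` and `n`, which is the tangent plane of a surface through `x`
with unit normal `n`. -/
def tangentPlane (x n : R41) : Submodule ℝ R41 where
  carrier := {a | lor a x = 0 ∧ lor a n = 0}
  add_mem' ha hb := by simp_all
  zero_mem' := by simp
  smul_mem' c a ha := by simp_all

variable {x n a b c d : R41}

namespace NormalFrame

/-- The Lagrange identity in the tangent plane. Both sides are, up to sign, the determinant of the
matrix of Lorentz products of the quadruples `x, n, a, b` and `x, n, c, d`. -/
lemma area_mul_area (h : NormalFrame x n) (ha : a ∈ tangentPlane x n) (hb : b ∈ tangentPlane x n)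
    (hc : c ∈ tangentPlane x n) (hd : d ∈ tangentPlane x n) :
    area x n a b * area x n c d = lor a c * lor b d - lor a d * lor b c := by
  let J : Matrix (Fin 4) (Fin 4) ℝ := Matrix.diagonal ![-1, 1, 1, 1]
  let G : Matrix (Fin 4) (Fin 4) ℝ :=
    !![-1, 0, 0, 0; 0, 1, 0, 0; 0, 0, lor a c, lor a d; 0, 0, lor b c, lor b d]
  have gram : Matrix.of ![x, n, a, b] * J * (Matrix.of ![x, n, c, d]).transpose = G := by
    have entry (X Y : Fin 4 → R41) (i j : Fin 4) :
        (Matrix.of X * J * (Matrix.of Y).transpose) i j = lor (X i) (Y j) := by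
      simp [Matrix.mul_apply, J, Matrix.diagonal, Fin.sum_univ_four, lor]
    ext i j
    rw [entry]
    fin_cases i <;> fin_cases j <;>
      simp [G, h.lor_self, h.lor_self_normal, h.lor_normal, lor_comm n x, ha.1, ha.2, hb.1, hb.2,
        lor_comm x c, lor_comm n c, lor_comm x d, lor_comm n d, hc.1, hc.2, hd.1, hd.2]
  have hJ : J.det = -1 := by simp [J, Fin.prod_univ_four]
  have hG : G.det = -(lor a c * lor b d - lor a d * lor b c) := by
    simp [G, Matrix.det_succ_row_zero, Fin.sum_univ_succ, Fin.succAbove]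
    ring
  have hdet := congrArg Matrix.det gram
  rw [Matrix.det_mul, Matrix.det_mul, Matrix.det_transpose, hJ, hG] at hdet
  unfold area
  linarith

lemma eq_zero_of_area_of_lor (h : NormalFrame x n) (ha : a ∈ tangentPlane x n)
    (hb : b ∈ tangentPlane x n) (ha0 : a ≠ 0) (harea : area x n a b = 0) (hlor : lor a b = 0) :
    b = 0 := by
  have hL := h.area_mul_area ha hb ha hb
  rw [harea, hlor] at hL
  have haa := lor_self_pos h.lor_self ha.1 ha0
  exact eq_zero_of_lor_self h.lor_self hb.1
    ((mul_eq_zero.1 (by linarith : lor a a * lor b b = 0)).resolve_left haa.ne')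

lemma lor_self_nonneg (h : NormalFrame x n) (ha : a ∈ tangentPlane x n) : 0 ≤ lor a a := by
  by_cases ha0 : a = 0
  · simp [ha0]
  · exact (lor_self_pos h.lor_self ha.1 ha0).le

lemma lor_self_mul_lor_self (h : NormalFrame x n) (ha : a ∈ tangentPlane x n)
    (hb : b ∈ tangentPlane x n) :
    lor a a * lor b b = area x n a b ^ 2 + lor a b ^ 2 := by
  linear_combination lor a b * lor_comm b a - h.area_mul_area ha hb ha hb

lemma lor_sq_le (h : NormalFrame x n) (ha : a ∈ tangentPlane x n) (hb : b ∈ tangentPlane x n) :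
    lor a b ^ 2 ≤ lor a a * lor b b := by
  rw [h.lor_self_mul_lor_self ha hb]
  exact le_add_of_nonneg_left (sq_nonneg _)

end NormalFrame

section mixedArea

variable {V : Type*} [AddCommGroup V] [Module ℝ V] [TopologicalSpace V] {A B : V →L[ℝ] R41}
  {v₀ v₁ : V}

/-- The polarization `A ∧ B + B ∧ A` of the area form, for linear maps `A` and `B` to the tangent
plane. -/
def mixedArea (x n : R41) (A B : V →L[ℝ] R41) (v w : V) : ℝ :=
  area x n (A v) (B w) + area x n (B v) (A w)

lemma mixedArea_comm (A B : V →L[ℝ] R41) (v w : V) :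
    mixedArea x n A B v w = mixedArea x n B A v w := add_comm _ _

lemma mixedArea_self (A : V →L[ℝ] R41) (v w : V) :
    mixedArea x n A A v w = 2 * area x n (A v) (A w) := (two_mul _).symm

lemma mixedArea_neg_normal (A B : V →L[ℝ] R41) (v w : V) :
    mixedArea x (-n) A B v w = -mixedArea x n A B v w := by
  simp only [mixedArea, area_neg_normal]; ring

lemma mixedArea_combination (a b c d : ℝ) (A B : V →L[ℝ] R41) (v w : V) :
    mixedArea x n (a • A + b • B) (c • A + d • B) v w =
      a * c * mixedArea x n A A v w + (a * d + b * c) * mixedArea x n A B v w +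
        b * d * mixedArea x n B B v w := by
  simp only [mixedArea, add_apply, smul_apply, area_add_right, area_smul_right, area_add_left,
    area_smul_left]
  ring

lemma mixedArea_eq_zero_of_span (hspan : Submodule.span ℝ {v₀, v₁} = ⊤)
    (h : mixedArea x n A B v₀ v₁ = 0) (v w : V) : mixedArea x n A B v w = 0 := by
  obtain ⟨a, b, rfl⟩ := Submodule.mem_span_pair.1 (hspan ▸ Submodule.mem_top (x := v))
  obtain ⟨c, d, rfl⟩ := Submodule.mem_span_pair.1 (hspan ▸ Submodule.mem_top (x := w))
  simp only [mixedArea, map_add, map_smul, area_add_left, area_smul_left, area_add_right,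
    area_smul_right] at h ⊢
  linear_combination (a * d - b * c) * h + a * c * area_swap x n (A v₀) (B v₀) +
    b * d * area_swap x n (A v₁) (B v₁) + b * c * area_swap x n (A v₁) (B v₀) +
    b * c * area_swap x n (B v₁) (A v₀)

lemma exists_ne_zero_of_not_injective (hA : ¬ Function.Injective A) : ∃ v ≠ 0, A v = 0 := by
  contrapose! hA
  exact (injective_iff_map_eq_zero A).2 fun v hv => by_contra fun hv0 => hA v hv0 hv

namespace NormalFrame

/-- If `A v = 0`, symmetry makes `A w` orthogonal to `B v`, and the vanishing of the mixed area
makes it parallel to `B v`. -/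
lemma eq_zero_of_mixedArea (h : NormalFrame x n) (hA : ∀ v, A v ∈ tangentPlane x n)
    (hB : ∀ v, B v ∈ tangentPlane x n) (hsymm : ∀ v w, lor (A v) (B w) = lor (A w) (B v))
    (hmix : ∀ v w, mixedArea x n A B v w = 0) (hker : ∀ v, A v = 0 → B v = 0 → v = 0)
    (hsing : ¬ Function.Injective A) : A = 0 := by
  obtain ⟨v, hv, hAv⟩ := exists_ne_zero_of_not_injective hsing
  ext1 w
  refine h.eq_zero_of_area_of_lor (hB v) (hA w) (fun hBv => hv (hker v hAv hBv)) ?_ ?_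
  · simpa [mixedArea, hAv] using hmix v w
  · rw [lor_comm, hsymm, hAv, lor_zero_left]

/-- A trace-free symmetric operator has nonpositive determinant. -/
lemma area_mul_area_nonpos (h : NormalFrame x n) (hA : ∀ v, A v ∈ tangentPlane x n)
    (hB : ∀ v, B v ∈ tangentPlane x n) (hsymm : ∀ v w, lor (A v) (B w) = lor (A w) (B v))
    (hmix : ∀ v w, mixedArea x n A B v w = 0) (v w : V) :
    area x n (A v) (A w) * area x n (B v) (B w) ≤ 0 := by
  have hcross : area x n (A w) (B v) = area x n (A v) (B w) := by
    have := hmix v w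
    rw [mixedArea] at this
    linear_combination area_swap x n (A w) (B v) - this
  have hvw := h.lor_self_mul_lor_self (hA v) (hB w)
  have hwv := h.lor_self_mul_lor_self (hA w) (hB v)
  rw [hcross, ← hsymm v w] at hwv
  have hdet : area x n (A v) (A w) * area x n (B v) (B w) =
      lor (A v) (A w) * lor (B v) (B w) - lor (A v) (A v) * lor (B w) (B w) := by
    have hAB := h.area_mul_area (hA v) (hA w) (hB v) (hB w)
    have hBA := h.area_mul_area (hA v) (hB w) (hA w) (hB v)
    rw [← hsymm v w] at hAB
    rw [hcross, lor_comm (B w) (A w), lor_comm (B w) (B v)] at hBA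
    linear_combination hAB + hBA + hvw
  have hcauchy_schwarz : (lor (A v) (A w) * lor (B v) (B w)) ^ 2 ≤
      (lor (A v) (A v) * lor (B w) (B w)) ^ 2 :=
    calc (lor (A v) (A w) * lor (B v) (B w)) ^ 2
        = lor (A v) (A w) ^ 2 * lor (B v) (B w) ^ 2 := mul_pow _ _ _
      _ ≤ (lor (A v) (A v) * lor (A w) (A w)) * (lor (B v) (B v) * lor (B w) (B w)) :=
        mul_le_mul (h.lor_sq_le (hA v) (hA w)) (h.lor_sq_le (hB v) (hB w)) (sq_nonneg _)
          (mul_nonneg (h.lor_self_nonneg (hA v)) (h.lor_self_nonneg (hA w)))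
      _ = (lor (A v) (A v) * lor (B w) (B w)) ^ 2 := by
        linear_combination lor (A v) (A v) * lor (B w) (B w) * (hwv - hvw)
  have hnonneg : 0 ≤ lor (A v) (A v) * lor (B w) (B w) :=
    mul_nonneg (h.lor_self_nonneg (hA v)) (h.lor_self_nonneg (hB w))
  rw [hdet]
  linarith [abs_le_of_sq_le_sq' hcauchy_schwarz hnonneg]

end NormalFrame

lemma eq_tbasis_combination (u : EuclideanSpace ℝ (Fin 2)) :
    u = u 0 • tbasis 0 + u 1 • tbasis 1 := by
  ext i
  fin_cases i <;> simp [tbasis]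

lemma span_tbasis : Submodule.span ℝ {tbasis 0, tbasis 1} = ⊤ :=
  eq_top_iff.2 fun u _ => Submodule.mem_span_pair.2 ⟨u 0, u 1, (eq_tbasis_combination u).symm⟩

lemma mixedArea_self_eq_zero_of_not_injective {A : EuclideanSpace ℝ (Fin 2) →L[ℝ] R41}
    (hA : ¬ Function.Injective A) (v w : EuclideanSpace ℝ (Fin 2)) :
    mixedArea x n A A v w = 0 := by
  refine mixedArea_eq_zero_of_span span_tbasis ?_ v w
  obtain ⟨u, hu, hAu⟩ := exists_ne_zero_of_not_injective hA
  rw [eq_tbasis_combination u, map_add, map_smul, map_smul] at hAu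
  rw [mixedArea_self, mul_eq_zero, or_iff_right two_ne_zero]
  by_contra harea
  have h0 : u 0 = 0 := by
    simpa [harea] using congrArg (fun a => area x n a (A (tbasis 1))) hAu
  have h1 : u 1 = 0 := by
    simpa [harea] using congrArg (fun a => area x n (A (tbasis 0)) a) hAu
  exact hu (by rw [eq_tbasis_combination u, h0, h1, zero_smul, zero_smul, add_zero])

/-- The vector `⟨A e₀, A e₁⟩ e₀ - ⟨A e₀, A e₀⟩ e₁` spans the kernel if `A e₀ ≠ 0`. -/
lemma NormalFrame.not_injective_of_mixedArea_self {A : EuclideanSpace ℝ (Fin 2) →L[ℝ] R41}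
    (h : NormalFrame x n) (hA : ∀ v, A v ∈ tangentPlane x n)
    (hmix : ∀ v w, mixedArea x n A A v w = 0) : ¬ Function.Injective A := by
  rw [injective_iff_map_eq_zero]
  intro hinj
  have hA₀ : A (tbasis 0) ≠ 0 := fun h0 => by simpa [tbasis] using hinj _ h0
  set v := lor (A (tbasis 0)) (A (tbasis 1)) • tbasis 0 +
    -lor (A (tbasis 0)) (A (tbasis 0)) • tbasis 1 with hv
  have hAv : A v = 0 := by
    have harea := hmix (tbasis 0) (tbasis 1)
    rw [mixedArea_self] at harea
    refine h.eq_zero_of_area_of_lor (hA (tbasis 0)) (hA v) hA₀ ?_ ?_ <;>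
      simp only [hv, map_add, map_smul, area_add_right, area_smul_right, area_self,
        lor_add_right, lor_smul_right]
    · linear_combination -lor (A (tbasis 0)) (A (tbasis 0)) * harea / 2
    · ring
  have hself : lor (A (tbasis 0)) (A (tbasis 0)) = 0 := by
    simpa [hv, tbasis] using congrArg (fun u : EuclideanSpace ℝ (Fin 2) => u 1) (hinj v hAv)
  exact (lor_self_pos h.lor_self (hA _).1 hA₀).ne' hself

lemma NormalFrame.not_injective_iff {A : EuclideanSpace ℝ (Fin 2) →L[ℝ] R41}
    (h : NormalFrame x n) (hA : ∀ v, A v ∈ tangentPlane x n) :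
    ¬ Function.Injective A ↔ ∀ v w, mixedArea x n A A v w = 0 :=
  ⟨mixedArea_self_eq_zero_of_not_injective, h.not_injective_of_mixedArea_self hA⟩

end mixedArea

/-! ### Directional derivatives and the Hopf differential -/

section calculus

variable {F : Type*} [NormedAddCommGroup F] [NormedSpace ℝ F] {T : Set ℂ} {w : ℂ}

/-- The derivative at `w` of a map on the complex plane, in the constant direction `c`. -/
def pd (g : ℂ → F) (c w : ℂ) : F := fderiv ℝ g w c

lemma pd_congr {g h : ℂ → F} (hT : IsOpen T) (hw : w ∈ T) (hgh : Set.EqOn g h T) (c : ℂ) :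
    pd g c w = pd h c w := by
  rw [pd, pd, (hgh.eventuallyEq_of_mem (hT.mem_nhds hw)).fderiv_eq]

lemma pd_const (k : F) (c : ℂ) : pd (fun _ => k) c w = 0 := by simp [pd]

lemma pd_eq_re_add_im (g : ℂ → F) (c : ℂ) :
    pd g c w = c.re • pd g 1 w + c.im • pd g Complex.I w := by
  simp only [pd, ← map_smul, ← map_add]
  congr 1
  apply Complex.ext <;> simp

lemma differentiableAt_of_contDiffOn {g : ℂ → F} (hT : IsOpen T) (hg : ContDiffOn ℝ ∞ g T)
    (hw : w ∈ T) : DifferentiableAt ℝ g w :=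
  (hg.contDiffAt (hT.mem_nhds hw)).differentiableAt (by simp)

lemma contDiffOn_pd {g : ℂ → F} (hT : IsOpen T) (hg : ContDiffOn ℝ ∞ g T) (c : ℂ) :
    ContDiffOn ℝ ∞ (pd g c) T :=
  (hg.fderiv_of_isOpen hT (by simp)).clm_apply contDiffOn_const

lemma pd_comm {g : ℂ → F} (hT : IsOpen T) (hg : ContDiffOn ℝ ∞ g T) (hw : w ∈ T) (c d : ℂ) :
    pd (pd g c) d w = pd (pd g d) c w := by
  have hg_symm : IsSymmSndFDerivAt ℝ g w := (hg.contDiffAt (hT.mem_nhds hw)).isSymmSndFDerivAt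
    (by simpa using WithTop.coe_le_coe.2 (le_top (a := (2 : ℕ∞))))
  have hdiff : DifferentiableAt ℝ (fderiv ℝ g) w :=
    ((hg.fderiv_of_isOpen (m := ∞) hT (by simp)).contDiffAt (hT.mem_nhds hw)).differentiableAt
      (by simp)
  have pd_pd (c d : ℂ) : pd (pd g c) d w = fderiv ℝ (fderiv ℝ g) w d c := by
    change fderiv ℝ (fun x => fderiv ℝ g x c) w d = _
    rw [fderiv_clm_apply hdiff (by fun_prop)]
    simp
  rw [pd_pd, pd_pd]
  exact hg_symm d c

lemma pd_lor {g h : ℂ → R41} (hg : DifferentiableAt ℝ g w) (hh : DifferentiableAt ℝ h w)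
    (c : ℂ) :
    pd (fun x => lor (g x) (h x)) c w = lor (pd g c w) (h w) + lor (g w) (pd h c w) := by
  have := congrArg (fun L => L c) (lorForm.fderiv_of_bilinear hg hh)
  simp only [add_apply, ContinuousLinearMap.precompR_apply,
    ContinuousLinearMap.precompL_apply, lorForm_apply] at this
  rw [add_comm]
  exact this

lemma lor_pd_add_lor_pd {g h : ℂ → R41} (hT : IsOpen T) (hg : ContDiffOn ℝ ∞ g T)
    (hh : ContDiffOn ℝ ∞ h T) {k : ℝ} (hk : ∀ x ∈ T, lor (g x) (h x) = k) (hw : w ∈ T) (c : ℂ) :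
    lor (pd g c w) (h w) + lor (g w) (pd h c w) = 0 := by
  rw [← pd_lor (differentiableAt_of_contDiffOn hT hg hw) (differentiableAt_of_contDiffOn hT hh hw),
    pd_congr hT hw hk, pd_const]

end calculus

section hopf

variable {T : Set ℂ} {Γ Δ : ℂ → R41} {w : ℂ}

/-- The map `Γ` is weakly conformal on `T`: its coordinate derivatives are orthogonal and of equal
length. -/
def IsConformalOn (Γ : ℂ → R41) (T : Set ℂ) : Prop :=
  ∀ w ∈ T, lor (pd Γ 1 w) (pd Γ 1 w) = lor (pd Γ Complex.I w) (pd Γ Complex.I w) ∧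
    lor (pd Γ 1 w) (pd Γ Complex.I w) = 0

/-- The differential of `Δ` at `w` is that of `Γ` composed with an operator which, in the
coordinate basis, has the trace-free symmetric matrix with rows `(α, β)` and `(β, -α)`. -/
def IsTraceFreeAt (Γ Δ : ℂ → R41) (w : ℂ) : Prop :=
  ∃ α β : ℝ, pd Δ 1 w = α • pd Γ 1 w + β • pd Γ Complex.I w ∧
    pd Δ Complex.I w = β • pd Γ 1 w + -α • pd Γ Complex.I w

/-- The coefficient of `dw²` in the quadratic differential of which `⟨dΔ, dΓ⟩` is the real
part. -/
def hopf (Γ Δ : ℂ → R41) (w : ℂ) : ℂ :=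
  (lor (pd Δ 1 w) (pd Γ 1 w) : ℂ) - lor (pd Δ 1 w) (pd Γ Complex.I w) * Complex.I

lemma IsTraceFreeAt.lor_pd (h : IsTraceFreeAt Γ Δ w) (hΓ : IsConformalOn Γ T) (hw : w ∈ T) :
    lor (pd Δ Complex.I w) (pd Γ 1 w) = lor (pd Δ 1 w) (pd Γ Complex.I w) ∧
      lor (pd Δ Complex.I w) (pd Γ Complex.I w) = -lor (pd Δ 1 w) (pd Γ 1 w) := by
  obtain ⟨α, β, h1, hI⟩ := h
  obtain ⟨hlen, horth⟩ := hΓ w hw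
  simp only [h1, hI, lor_add_left, lor_smul_left, lor_comm (pd Γ Complex.I w) (pd Γ 1 w), hlen,
    horth]
  constructor <;> ring

lemma IsTraceFreeAt.hopf_eq_zero_iff (h : IsTraceFreeAt Γ Δ w) (hΓ : IsConformalOn Γ T)
    (hw : w ∈ T) (h0 : lor (pd Γ 1 w) (pd Γ 1 w) ≠ 0) :
    hopf Γ Δ w = 0 ↔ ∀ c, pd Δ c w = 0 := by
  constructor
  · intro hzero
    obtain ⟨α, β, h1, hI⟩ := h
    obtain ⟨hlen, horth⟩ := hΓ w hw
    have hα : α * lor (pd Γ 1 w) (pd Γ 1 w) = 0 := by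
      simpa [hopf, h1, lor_comm (pd Γ Complex.I w) (pd Γ 1 w), horth] using
        congrArg Complex.re hzero
    have hβ : β * lor (pd Γ 1 w) (pd Γ 1 w) = 0 := by
      simpa [hopf, h1, horth, hlen] using congrArg Complex.im hzero
    rw [(mul_eq_zero.1 hα).resolve_right h0, (mul_eq_zero.1 hβ).resolve_right h0] at h1 hI
    intro c
    simp [pd_eq_re_add_im Δ c, h1, hI]
  · intro hΔ
    simp [hopf, hΔ]

/-- By conformality the Christoffel terms cancel, for every direction of differentiation. -/
lemma IsTraceFreeAt.lor_pd_pd (h : IsTraceFreeAt Γ Δ w) (hΓ : IsConformalOn Γ T) (hT : IsOpen T)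
    (hΓs : ContDiffOn ℝ ∞ Γ T) (hw : w ∈ T) (c : ℂ) :
    lor (pd Δ 1 w) (pd (pd Γ Complex.I) c w) = lor (pd Δ Complex.I w) (pd (pd Γ 1) c w) := by
  obtain ⟨α, β, h1, hI⟩ := h
  have hd (d : ℂ) : DifferentiableAt ℝ (pd Γ d) w :=
    differentiableAt_of_contDiffOn hT (contDiffOn_pd hT hΓs d) hw
  have hlen := pd_congr hT hw (fun x hx => (hΓ x hx).1) c
  rw [pd_lor (hd _) (hd _), pd_lor (hd _) (hd _), lor_comm (pd (pd Γ 1) c w),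
    lor_comm (pd (pd Γ Complex.I) c w)] at hlen
  have horth := lor_pd_add_lor_pd hT (contDiffOn_pd hT hΓs 1) (contDiffOn_pd hT hΓs Complex.I)
    (fun x hx => (hΓ x hx).2) hw c
  rw [lor_comm (pd (pd Γ 1) c w)] at horth
  simp only [h1, hI, lor_add_left, lor_smul_left]
  linear_combination α * horth - β / 2 * hlen

lemma hasFDerivAt_ofReal_sub_mul_I {a b : ℂ → ℝ} (ha : DifferentiableAt ℝ a w)
    (hb : DifferentiableAt ℝ b w) :
    HasFDerivAt (fun x => (a x : ℂ) - b x * Complex.I)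
      (Complex.ofRealCLM ∘L fderiv ℝ a w -
        Complex.I • Complex.ofRealCLM ∘L fderiv ℝ b w) w := by
  have := (Complex.ofRealCLM.hasFDerivAt.comp w ha.hasFDerivAt).sub
    ((Complex.ofRealCLM.hasFDerivAt.comp w hb.hasFDerivAt).mul_const Complex.I)
  exact this

/-- The Codazzi equation is the Cauchy–Riemann equation of the Hopf differential. -/
lemma differentiableOn_hopf (hT : IsOpen T) (hΓs : ContDiffOn ℝ ∞ Γ T)
    (hΔs : ContDiffOn ℝ ∞ Δ T) (hΓ : IsConformalOn Γ T) (hΔ : ∀ w ∈ T, IsTraceFreeAt Γ Δ w) :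
    DifferentiableOn ℂ (hopf Γ Δ) T := by
  intro w hw
  have hdΓ (c : ℂ) : DifferentiableAt ℝ (pd Γ c) w :=
    differentiableAt_of_contDiffOn hT (contDiffOn_pd hT hΓs c) hw
  have hdΔ (c : ℂ) : DifferentiableAt ℝ (pd Δ c) w :=
    differentiableAt_of_contDiffOn hT (contDiffOn_pd hT hΔs c) hw
  have hd (c d : ℂ) : DifferentiableAt ℝ (fun x => lor (pd Δ c x) (pd Γ d x)) w :=
    (lorForm.hasFDerivAt_of_bilinear (hdΔ c).hasFDerivAt (hdΓ d).hasFDerivAt).differentiableAt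
  set a : ℂ → ℝ := fun x => lor (pd Δ 1 x) (pd Γ 1 x)
  set b : ℂ → ℝ := fun x => lor (pd Δ 1 x) (pd Γ Complex.I x)
  have h_codazzi := (hΔ w hw).lor_pd_pd hΓ hT hΓs hw
  have hCR₁ : pd a Complex.I w = pd b 1 w := by
    rw [pd_congr hT hw (g := b) fun x hx => ((hΔ x hx).lor_pd hΓ hx).1.symm,
      pd_lor (hdΔ _) (hdΓ _), pd_lor (hdΔ _) (hdΓ _), pd_comm hT hΔs hw, ← h_codazzi,
      pd_comm hT hΓs hw 1]
  have hCR₂ : pd b Complex.I w = -pd a 1 w := by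
    have hneg : pd (fun x => -a x) 1 w = -pd a 1 w := by
      simp only [pd, fderiv_fun_neg, neg_apply]
    rw [← hneg, pd_congr hT hw (g := fun x => -a x) fun x hx => ((hΔ x hx).lor_pd hΓ hx).2.symm,
      pd_lor (hdΔ _) (hdΓ _), pd_lor (hdΔ _) (hdΓ _), pd_comm hT hΔs hw, h_codazzi,
      pd_comm hT hΓs hw 1]
  have hfderiv := hasFDerivAt_ofReal_sub_mul_I (hd 1 1) (hd 1 Complex.I)
  refine (differentiableAt_complex_iff_differentiableAt_real.2
    ⟨hfderiv.differentiableAt, ?_⟩).differentiableWithinAt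
  change fderiv ℝ (fun x => (a x : ℂ) - b x * Complex.I) w Complex.I =
    Complex.I • fderiv ℝ (fun x => (a x : ℂ) - b x * Complex.I) w 1
  rw [hfderiv.fderiv]
  change ((pd a Complex.I w : ℝ) : ℂ) - Complex.I * ((pd b Complex.I w : ℝ) : ℂ) =
    Complex.I * (((pd a 1 w : ℝ) : ℂ) - Complex.I * ((pd b 1 w : ℝ) : ℂ))
  rw [hCR₁, hCR₂]
  push_cast
  linear_combination ((pd b 1 w : ℝ) : ℂ) * Complex.I_sq

end hopf

lemma NormalFrame.eq_smul_add_smul (h : NormalFrame x n) (ha : a ∈ tangentPlane x n)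
    (hb : b ∈ tangentPlane x n) (hab : lor a b = 0) (hlen : lor a a = lor b b) (ha0 : a ≠ 0)
    (hc : c ∈ tangentPlane x n) :
    c = (lor c a / lor a a) • a + (lor c b / lor a a) • b := by
  have hpos := lor_self_pos h.lor_self ha.1 ha0
  have harea : area x n a b ≠ 0 := by
    have := h.area_mul_area ha hb ha hb
    rw [hab, ← hlen, zero_mul, sub_zero] at this
    exact left_ne_zero_of_mul (this ▸ (mul_pos hpos hpos).ne')
  set r := c + (-(lor c a / lor a a) • a + -(lor c b / lor a a) • b) with hr
  have hr_mem : r ∈ tangentPlane x n :=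
    add_mem hc (add_mem (Submodule.smul_mem _ _ ha) (Submodule.smul_mem _ _ hb))
  have hr_a : lor a r = 0 := by
    simp only [hr, lor_add_right, lor_smul_right, hab, lor_comm a c]
    field_simp
    ring
  have hr_b : lor r b = 0 := by
    simp only [hr, lor_add_left, lor_smul_left, hab, ← hlen]
    field_simp
    ring
  have hr_area : area x n a r = 0 := by
    have := h.area_mul_area ha hr_mem ha hb
    rw [hr_b, hab, mul_zero, zero_mul, sub_zero] at this
    exact (mul_eq_zero.1 this).resolve_right harea
  have hzero := h.eq_zero_of_area_of_lor ha hr_mem ha0 hr_area hr_a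
  rwa [hr, neg_smul, neg_smul, ← neg_add, ← sub_eq_add_neg, sub_eq_zero] at hzero

lemma NormalFrame.exists_trace_free (h : NormalFrame x n) (ha : a ∈ tangentPlane x n)
    (hb : b ∈ tangentPlane x n) (hc : c ∈ tangentPlane x n) (hd : d ∈ tangentPlane x n)
    (hab : lor a b = 0) (hlen : lor a a = lor b b) (ha0 : a ≠ 0) (hsymm : lor c b = lor d a)
    (harea : area x n a d + area x n c b = 0) :
    ∃ α β : ℝ, c = α • a + β • b ∧ d = β • a + -α • b := by
  have htrace : lor d b = -lor c a := by
    have h1 := h.area_mul_area ha hb ha hd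
    have h2 := h.area_mul_area ha hb hc hb
    rw [lor_comm a d, ← hsymm, lor_comm b d, lor_comm b a, hab] at h1
    rw [hab, lor_comm a c, ← hlen] at h2
    have : lor a a * (lor d b + lor c a) = 0 := by
      linear_combination area x n a b * harea - h1 - h2
    linarith [(mul_eq_zero.1 this).resolve_left (lor_self_pos h.lor_self ha.1 ha0).ne']
  refine ⟨lor c a / lor a a, lor c b / lor a a, h.eq_smul_add_smul ha hb hab hlen ha0 hc, ?_⟩
  rw [← neg_div, ← htrace, hsymm]
  exact h.eq_smul_add_smul ha hb hab hlen ha0 hd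

/-! ### Parametrizations of a surface by open subsets of the complex plane -/

section param

variable {M : Type*} [TopologicalSpace M] [ChartedSpace (EuclideanSpace ℝ (Fin 2)) M]

/-- A diffeomorphism between an open subset of `M` and an open subset of `ℂ`. -/
structure IsParam (e : OpenPartialHomeomorph M ℂ) : Prop where
  smooth : ContMDiffOn (𝓡 2) 𝓘(ℝ, ℂ) ∞ e e.source
  smooth_symm : ContMDiffOn 𝓘(ℝ, ℂ) (𝓡 2) ∞ e.symm e.target

/-- The differential at `w` of the inverse of `e`, which carries the coordinate directions to the
tangent plane of `M`. -/
def frame (e : OpenPartialHomeomorph M ℂ) (w : ℂ) : ℂ →L[ℝ] EuclideanSpace ℝ (Fin 2) :=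
  mfderiv 𝓘(ℝ, ℂ) (𝓡 2) e.symm w

section

variable {F : Type*} [NormedAddCommGroup F] [NormedSpace ℝ F] {g : M → F} {U : Set M} {q : M}

lemma mdifferentiableAt_of_contMDiffOn (hU : IsOpen U) (hg : ContMDiffOn (𝓡 2) 𝓘(ℝ, F) ∞ g U)
    (hq : q ∈ U) : MDifferentiableAt (𝓡 2) 𝓘(ℝ, F) g q :=
  ((hg q hq).contMDiffAt (hU.mem_nhds hq)).mdifferentiableAt (by simp)

end

namespace IsParam

variable {e : OpenPartialHomeomorph M ℂ} {w : ℂ} {U : Set M}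

lemma restrOpen (he : IsParam e) (hU : IsOpen U) : IsParam (e.restrOpen U hU) where
  smooth := he.smooth.mono (e.restrOpen_source U hU ▸ Set.inter_subset_left)
  smooth_symm := he.smooth_symm.mono fun _ hw => hw.1

lemma trans (he : IsParam e) {φ : OpenPartialHomeomorph ℂ ℂ} (hφ : ContDiffOn ℝ ∞ φ φ.source)
    (hφ_symm : ContDiffOn ℝ ∞ φ.symm φ.target) : IsParam (e.trans φ) where
  smooth := hφ.contMDiffOn.comp (he.smooth.mono fun _ hq => hq.1) fun _ hq => hq.2
  smooth_symm := he.smooth_symm.comp (hφ_symm.contMDiffOn.mono fun _ hw => hw.1) fun _ hw => hw.2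

variable {F : Type*} [NormedAddCommGroup F] [NormedSpace ℝ F] {g : M → F}

lemma contDiffOn_comp_symm (he : IsParam e) (hg : ContMDiffOn (𝓡 2) 𝓘(ℝ, F) ∞ g U)
    (hU : e.source ⊆ U) : ContDiffOn ℝ ∞ (g ∘ e.symm) e.target :=
  (hg.comp he.smooth_symm fun _ hw => hU (e.map_target hw)).contDiffOn

lemma pd_comp_symm (he : IsParam e) (hw : w ∈ e.target)
    (hg : MDifferentiableAt (𝓡 2) 𝓘(ℝ, F) g (e.symm w)) (c : ℂ) :
    pd (g ∘ e.symm) c w = mfderiv (𝓡 2) 𝓘(ℝ, F) g (e.symm w) (frame e w c) := by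
  have he_symm : MDifferentiableAt 𝓘(ℝ, ℂ) (𝓡 2) e.symm w :=
    ((he.smooth_symm w hw).contMDiffAt (e.open_target.mem_nhds hw)).mdifferentiableAt (by simp)
  rw [pd, ← mfderiv_eq_fderiv, mfderiv_comp w hg he_symm]
  rfl

lemma frame_injective (he : IsParam e) (hw : w ∈ e.target) : Function.Injective (frame e w) := by
  have he_diff := mdifferentiableAt_of_contMDiffOn e.open_source he.smooth (e.map_target hw)
  have hid : Set.EqOn (e ∘ e.symm) id e.target := fun _ hx => e.right_inv hx
  have hinv (c : ℂ) : mfderiv (𝓡 2) 𝓘(ℝ, ℂ) e (e.symm w) (frame e w c) = c := by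
    rw [← he.pd_comp_symm hw he_diff, pd_congr e.open_target hw hid, pd, fderiv_id]
    rfl
  exact Function.LeftInverse.injective hinv

lemma frame_surjective (he : IsParam e) (hw : w ∈ e.target) : Function.Surjective (frame e w) :=
  (LinearMap.injective_iff_surjective_of_finrank_eq_finrank (f := (frame e w).toLinearMap)
    (by simp [Complex.finrank_real_complex])).1 (he.frame_injective hw)

lemma exists_pd_eq_zero {g : M → R41} (he : IsParam e) (hU : IsOpen U)
    (hg : ContMDiffOn (𝓡 2) 𝓘(ℝ, R41) ∞ g U) (heU : e.source ⊆ U) (hw : w ∈ e.target)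
    (hker : ∃ v ≠ 0, diff g (e.symm w) v = 0) : ∃ c ≠ 0, pd (g ∘ e.symm) c w = 0 := by
  obtain ⟨v, hv, hgv⟩ := hker
  obtain ⟨c, rfl⟩ := he.frame_surjective hw v
  exact ⟨c, fun hc => hv (by rw [hc, map_zero]), (he.pd_comp_symm hw
    (mdifferentiableAt_of_contMDiffOn hU hg (heU (e.map_target hw))) c).trans hgv⟩

end IsParam

/-- The inverse function theorem. -/
lemma exists_diffeomorph_of_injective_fderiv {F : ℂ → ℂ} {T : Set ℂ} {w : ℂ} (hT : IsOpen T)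
    (hF : ContDiffOn ℝ ∞ F T) (hw : w ∈ T) (hinj : Function.Injective (fderiv ℝ F w)) :
    ∃ φ : OpenPartialHomeomorph ℂ ℂ, ⇑φ = F ∧ w ∈ φ.source ∧ φ.source ⊆ T ∧
      ContDiffOn ℝ ∞ φ.symm φ.target := by
  have hF_at (x : ℂ) (hx : x ∈ T) : ContDiffAt ℝ ∞ F x := hF.contDiffAt (hT.mem_nhds hx)
  let L : ℂ ≃L[ℝ] ℂ :=
    (LinearEquiv.ofInjectiveEndo (fderiv ℝ F w).toLinearMap hinj).toContinuousLinearEquiv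
  have hL : (L : ℂ →L[ℝ] ℂ) = fderiv ℝ F w := rfl
  have hderiv : HasFDerivAt F (L : ℂ →L[ℝ] ℂ) w :=
    hL ▸ ((hF_at w hw).differentiableAt (by simp)).hasFDerivAt
  let φ := (hF_at w hw).toOpenPartialHomeomorph F hderiv (by simp)
  have hcont : ContinuousAt (fderiv ℝ F) w :=
    (hF.continuousOn_fderiv_of_isOpen hT (by simp)).continuousAt (hT.mem_nhds hw)
  have hinvertible : ∀ᶠ x in 𝓝 w, x ∈ T ∧ ∃ L' : ℂ ≃L[ℝ] ℂ, (L' : ℂ →L[ℝ] ℂ) = fderiv ℝ F x :=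
    (hT.eventually_mem hw).and (hcont.eventually (hL ▸ ContinuousLinearEquiv.nhds L))
  obtain ⟨S, hS, hSo, hwS⟩ := mem_nhds_iff.1 hinvertible
  refine ⟨φ.restrOpen S hSo, rfl,
    ⟨(hF_at w hw).mem_toOpenPartialHomeomorph_source hderiv (by simp), hwS⟩,
    fun x hx => (hS hx.2).1, fun y hy => ?_⟩
  obtain ⟨hyT, L', hL'⟩ := hS ((φ.restrOpen S hSo).map_target hy).2
  refine (OpenPartialHomeomorph.contDiffAt_symm _ (f₀' := L') hy ?_
    (hF_at _ hyT)).contDiffWithinAt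
  exact hL' ▸ ((hF_at _ hyT).differentiableAt (by simp)).hasFDerivAt

variable [IsManifold (𝓡 2) ∞ M] {U : Set M} {p : M}

lemma exists_param (p : M) (hU : IsOpen U) (hp : p ∈ U) :
    ∃ e : OpenPartialHomeomorph M ℂ, IsParam e ∧ p ∈ e.source ∧ e.source ⊆ U := by
  let L : EuclideanSpace ℝ (Fin 2) ≃L[ℝ] ℂ :=
    Complex.orthonormalBasisOneI.repr.symm.toContinuousLinearEquiv
  let e : OpenPartialHomeomorph M ℂ :=
    (chartAt (EuclideanSpace ℝ (Fin 2)) p).trans L.toHomeomorph.toOpenPartialHomeomorph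
  have he : IsParam e :=
    { smooth := (L.contDiff.contMDiff (n := ∞)).contMDiffOn.comp (t := Set.univ)
        ((contMDiffOn_chart (I := 𝓡 2) (n := ∞) (x := p)).mono fun _ hq => hq.1)
        fun _ _ => Set.mem_univ _
      smooth_symm := (contMDiffOn_chart_symm (I := 𝓡 2) (n := ∞) (x := p)).comp
        (L.symm.contDiff.contMDiff (n := ∞)).contMDiffOn fun _ hw => hw.2 }
  exact ⟨e.restrOpen U hU, he.restrOpen hU, ⟨⟨mem_chart_source _ p, trivial⟩, hp⟩, fun _ hq => hq.2⟩

lemma exists_param_of_injective {z : M → ℂ} (hU : IsOpen U) (hp : p ∈ U)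
    (hz : ContMDiffOn (𝓡 2) 𝓘(ℝ, ℂ) ∞ z U)
    (hinj : Function.Injective (mfderiv (𝓡 2) 𝓘(ℝ, ℂ) z p)) :
    ∃ e : OpenPartialHomeomorph M ℂ, IsParam e ∧ p ∈ e.source ∧ e.source ⊆ U ∧
      Set.EqOn e z e.source := by
  obtain ⟨e, he, hpe, heU⟩ := exists_param p hU hp
  have hw := e.map_source hpe
  have hinj' : Function.Injective (fderiv ℝ (z ∘ e.symm) (e p)) := by
    have hcomp : ⇑(fderiv ℝ (z ∘ e.symm) (e p)) =
        mfderiv (𝓡 2) 𝓘(ℝ, ℂ) z (e.symm (e p)) ∘ frame e (e p) :=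
      funext (he.pd_comp_symm hw (mdifferentiableAt_of_contMDiffOn hU hz
        (heU (e.map_target hw))))
    rw [hcomp]
    refine Function.Injective.comp ?_ (he.frame_injective hw)
    rwa [e.left_inv hpe]
  obtain ⟨φ, hφ, hpφ, hφT, hφ_symm⟩ := exists_diffeomorph_of_injective_fderiv e.open_target
    (he.contDiffOn_comp_symm hz heU) hw hinj'
  have hφ_smooth : ContDiffOn ℝ ∞ φ φ.source :=
    hφ ▸ (he.contDiffOn_comp_symm hz heU).mono hφT
  refine ⟨e.trans φ, he.trans hφ_smooth hφ_symm, ⟨hpe, hpφ⟩, fun q hq => heU hq.1, fun q hq => ?_⟩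
  rw [OpenPartialHomeomorph.coe_trans, hφ]
  exact congrArg z (e.left_inv hq.1)

end param

/-! ### Legendrian maps -/

section comb

variable {M : Type*}

/-- Linear combinations with constant coefficients of `f` and its normal: this comprises `f` and
`ν`, the parallel fronts `f_δ` and `ν_δ`, and the lightlike Gauss maps `f ± ν`. -/
def comb (a b : ℝ) (f ν : M → R41) : M → R41 := fun p => a • f p + b • ν p

lemma comb_one_zero (f ν : M → R41) : comb 1 0 f ν = f := by
  funext p; simp [comb]

lemma comb_zero_one (f ν : M → R41) : comb 0 1 f ν = ν := by
  funext p; simp [comb]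

lemma par_eq_comb (δ : ℝ) (f ν : M → R41) :
    par δ f ν = comb (Real.cosh δ) (Real.sinh δ) f ν := rfl

lemma par_normal_eq_comb (δ : ℝ) (f ν : M → R41) :
    par δ ν f = comb (Real.sinh δ) (Real.cosh δ) f ν :=
  funext fun _ => add_comm _ _

end comb

section legendrian

variable {M : Type*} [TopologicalSpace M] [ChartedSpace (EuclideanSpace ℝ (Fin 2)) M]

/-- On the open set `U`, `f` is a smooth map to the hyperboloid with smooth unit normal `ν`. -/
structure LegendrianOn (f ν : M → R41) (U : Set M) : Prop where
  isOpen : IsOpen U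
  smooth : ContMDiffOn (𝓡 2) 𝓘(ℝ, R41) ∞ f U
  smooth_normal : ContMDiffOn (𝓡 2) 𝓘(ℝ, R41) ∞ ν U
  normalFrame : ∀ p ∈ U, NormalFrame (f p) (ν p)
  lor_diff_normal : ∀ p ∈ U, ∀ v, lor (diff f p v) (ν p) = 0

variable {f ν : M → R41} {U V : Set M} {p : M}

namespace LegendrianOn

lemma mono (h : LegendrianOn f ν U) (hV : IsOpen V) (hVU : V ⊆ U) : LegendrianOn f ν V where
  isOpen := hV
  smooth := h.smooth.mono hVU
  smooth_normal := h.smooth_normal.mono hVU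
  normalFrame p hp := h.normalFrame p (hVU hp)
  lor_diff_normal p hp := h.lor_diff_normal p (hVU hp)

lemma diff_comb (h : LegendrianOn f ν U) (hp : p ∈ U) (a b : ℝ) :
    diff (comb a b f ν) p = a • diff f p + b • diff ν p :=
  (((mdifferentiableAt_of_contMDiffOn h.isOpen h.smooth hp).hasMFDerivAt.const_smul a).add
    ((mdifferentiableAt_of_contMDiffOn h.isOpen h.smooth_normal hp).hasMFDerivAt.const_smul
      b)).mfderiv

lemma smooth_comb (h : LegendrianOn f ν U) (a b : ℝ) :
    ContMDiffOn (𝓡 2) 𝓘(ℝ, R41) ∞ (comb a b f ν) U :=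
  have hcomb : ContDiff ℝ ∞ fun x : R41 × R41 => a • x.1 + b • x.2 := by fun_prop
  hcomb.contMDiff.comp_contMDiffOn (h.smooth.prodMk_space h.smooth_normal)

lemma mixedArea_comb (h : LegendrianOn f ν U) (hp : p ∈ U) (a b c d : ℝ)
    (v w : EuclideanSpace ℝ (Fin 2)) :
    mixedArea (f p) (ν p) (diff (comb a b f ν) p) (diff (comb c d f ν) p) v w =
      a * c * mixedArea (f p) (ν p) (diff f p) (diff f p) v w +
        (a * d + b * c) * mixedArea (f p) (ν p) (diff f p) (diff ν p) v w +
        b * d * mixedArea (f p) (ν p) (diff ν p) (diff ν p) v w := by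
  rw [h.diff_comb hp, h.diff_comb hp, mixedArea_combination]

lemma eq_zero_of_diff_comb (h : LegendrianOn f ν U) (hp : p ∈ U)
    (hpair : ∀ v, diff f p v = 0 → diff ν p v = 0 → v = 0) {a b c d : ℝ}
    (hdet : a * d - b * c ≠ 0) {v : EuclideanSpace ℝ (Fin 2)}
    (hab : diff (comb a b f ν) p v = 0) (hcd : diff (comb c d f ν) p v = 0) : v = 0 := by
  rw [h.diff_comb hp, add_apply, smul_apply, smul_apply] at hab hcd
  have hf : (a * d - b * c) • diff f p v = 0 := by
    linear_combination (norm := module) d • hab - b • hcd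
  have hν : (a * d - b * c) • diff ν p v = 0 := by
    linear_combination (norm := module) a • hcd - c • hab
  exact hpair v ((smul_eq_zero.1 hf).resolve_left hdet) ((smul_eq_zero.1 hν).resolve_left hdet)

lemma lor_comb (h : LegendrianOn f ν U) (hp : p ∈ U) (a b c d : ℝ) :
    lor (comb a b f ν p) (comb c d f ν p) = b * d - a * c := by
  obtain ⟨hff, hνν, hfν⟩ := h.normalFrame p hp
  simp only [comb, lor_add_left, lor_add_right, lor_smul_left, lor_smul_right, hff, hνν, hfν,
    lor_comm (ν p) (f p)]
  ring

lemma pd_comb (h : LegendrianOn f ν U) {e : OpenPartialHomeomorph M ℂ} (he : IsParam e)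
    (heU : e.source ⊆ U) {w : ℂ} (hw : w ∈ e.target) (a b : ℝ) (c : ℂ) :
    pd (comb a b f ν ∘ e.symm) c w = diff (comb a b f ν) (e.symm w) (frame e w c) :=
  he.pd_comp_symm hw
    (mdifferentiableAt_of_contMDiffOn h.isOpen (h.smooth_comb a b) (heU (e.map_target hw))) c

end LegendrianOn

/-- The mixed area of the differentials at `p` of `a f + b ν` and `c f + d ν` vanishes. Singular
points, flatness and every linear Weingarten relation are of this form. -/
def MixedAreaZero (f ν : M → R41) (a b c d : ℝ) (p : M) : Prop :=
  ∀ v w, mixedArea (f p) (ν p) (diff (comb a b f ν) p) (diff (comb c d f ν) p) v w = 0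

variable [IsManifold (𝓡 2) ∞ M]

lemma lor_diff_add_lor_diff {g h : M → R41} (hU : IsOpen U)
    (hg : ContMDiffOn (𝓡 2) 𝓘(ℝ, R41) ∞ g U) (hh : ContMDiffOn (𝓡 2) 𝓘(ℝ, R41) ∞ h U) {k : ℝ}
    (hk : ∀ q ∈ U, lor (g q) (h q) = k) (hp : p ∈ U) (v : EuclideanSpace ℝ (Fin 2)) :
    lor (diff g p v) (h p) + lor (g p) (diff h p v) = 0 := by
  obtain ⟨e, he, hpe, heU⟩ := exists_param p hU hp
  obtain ⟨w, hw, rfl⟩ : ∃ w ∈ e.target, e.symm w = p := ⟨e p, e.map_source hpe, e.left_inv hpe⟩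
  obtain ⟨c, rfl⟩ := he.frame_surjective hw v
  have := lor_pd_add_lor_pd e.open_target (he.contDiffOn_comp_symm hg heU)
    (he.contDiffOn_comp_symm hh heU) (fun x hx => hk _ (heU (e.map_target hx))) hw c
  rwa [he.pd_comp_symm hw (mdifferentiableAt_of_contMDiffOn hU hg hp),
    he.pd_comp_symm hw (mdifferentiableAt_of_contMDiffOn hU hh hp)] at this

namespace LegendrianOn

lemma diff_mem_tangentPlane (h : LegendrianOn f ν U) (hp : p ∈ U)
    (v : EuclideanSpace ℝ (Fin 2)) : diff f p v ∈ tangentPlane (f p) (ν p) := by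
  have := lor_diff_add_lor_diff h.isOpen h.smooth h.smooth
    (fun q hq => (h.normalFrame q hq).lor_self) hp v
  rw [lor_comm (f p)] at this
  exact ⟨by linarith, h.lor_diff_normal p hp v⟩

lemma diff_normal_mem_tangentPlane (h : LegendrianOn f ν U) (hp : p ∈ U)
    (v : EuclideanSpace ℝ (Fin 2)) : diff ν p v ∈ tangentPlane (f p) (ν p) := by
  have hnn := lor_diff_add_lor_diff h.isOpen h.smooth_normal h.smooth_normal
    (fun q hq => (h.normalFrame q hq).lor_self_normal) hp v
  have hfn := lor_diff_add_lor_diff h.isOpen h.smooth h.smooth_normal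
    (fun q hq => (h.normalFrame q hq).lor_normal) hp v
  rw [lor_comm (ν p)] at hnn
  rw [h.lor_diff_normal p hp, zero_add, lor_comm] at hfn
  exact ⟨hfn, by linarith⟩

lemma diff_comb_mem_tangentPlane (h : LegendrianOn f ν U) (hp : p ∈ U) (a b : ℝ)
    (v : EuclideanSpace ℝ (Fin 2)) :
    diff (comb a b f ν) p v ∈ tangentPlane (f p) (ν p) := by
  rw [h.diff_comb hp]
  exact add_mem (Submodule.smul_mem _ a (h.diff_mem_tangentPlane hp v))
    (Submodule.smul_mem _ b (h.diff_normal_mem_tangentPlane hp v))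

/-- The second fundamental form is `⟨d²f, ν⟩`. -/
lemma lor_diff_comm (h : LegendrianOn f ν U) (hp : p ∈ U) (v w : EuclideanSpace ℝ (Fin 2)) :
    lor (diff f p v) (diff ν p w) = lor (diff f p w) (diff ν p v) := by
  obtain ⟨e, he, hpe, heU⟩ := exists_param p h.isOpen hp
  obtain ⟨x, hx, rfl⟩ : ∃ x ∈ e.target, e.symm x = p := ⟨e p, e.map_source hpe, e.left_inv hpe⟩
  have hf (y : ℂ) (hy : y ∈ e.target) (c : ℂ) :
      pd (f ∘ e.symm) c y = diff f (e.symm y) (frame e y c) :=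
    he.pd_comp_symm hy (mdifferentiableAt_of_contMDiffOn h.isOpen h.smooth
      (heU (e.map_target hy))) c
  have hν (c : ℂ) : pd (ν ∘ e.symm) c x = diff ν (e.symm x) (frame e x c) :=
    he.pd_comp_symm hx (mdifferentiableAt_of_contMDiffOn h.isOpen h.smooth_normal hp) c
  have hf_smooth := he.contDiffOn_comp_symm h.smooth heU
  have second_form (c d : ℂ) : lor (pd (pd (f ∘ e.symm) c) d x) (ν (e.symm x)) +
      lor (pd (f ∘ e.symm) c x) (pd (ν ∘ e.symm) d x) = 0 :=
    lor_pd_add_lor_pd e.open_target (contDiffOn_pd e.open_target hf_smooth c)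
      (he.contDiffOn_comp_symm h.smooth_normal heU)
      (fun y hy => hf y hy c ▸ h.lor_diff_normal _ (heU (e.map_target hy)) _) hx d
  obtain ⟨c, rfl⟩ := he.frame_surjective hx v
  obtain ⟨d, rfl⟩ := he.frame_surjective hx w
  have hcd := second_form c d
  have hdc := second_form d c
  rw [pd_comm e.open_target hf_smooth hx] at hcd
  rw [← hf x hx, ← hf x hx, ← hν, ← hν]
  linarith

lemma lor_diff_comb_comm (h : LegendrianOn f ν U) (hp : p ∈ U) (a b c d : ℝ)
    (v w : EuclideanSpace ℝ (Fin 2)) :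
    lor (diff (comb a b f ν) p v) (diff (comb c d f ν) p w) =
      lor (diff (comb a b f ν) p w) (diff (comb c d f ν) p v) := by
  simp only [h.diff_comb hp, add_apply, smul_apply, lor_add_left, lor_add_right, lor_smul_left,
    lor_smul_right]
  rw [lor_comm (diff f p w) (diff f p v), lor_comm (diff ν p w) (diff ν p v),
    lor_comm (diff ν p v) (diff f p w), lor_comm (diff ν p w) (diff f p v),
    h.lor_diff_comm hp v w]

lemma not_isRegularPt_comb_iff (h : LegendrianOn f ν U) (hp : p ∈ U) (a b : ℝ) :
    ¬ IsRegularPt (comb a b f ν) p ↔ MixedAreaZero f ν a b a b p :=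
  (h.normalFrame p hp).not_injective_iff (h.diff_comb_mem_tangentPlane hp a b)

lemma diff_comb_eq_zero_of_singular (h : LegendrianOn f ν U) (hp : p ∈ U)
    (hpair : ∀ v, diff f p v = 0 → diff ν p v = 0 → v = 0) {a b c d : ℝ}
    (hdet : a * d - b * c ≠ 0) (hmix : MixedAreaZero f ν a b c d p)
    (hsing : ¬ IsRegularPt (comb a b f ν) p) : diff (comb a b f ν) p = 0 :=
  (h.normalFrame p hp).eq_zero_of_mixedArea (h.diff_comb_mem_tangentPlane hp a b)
    (h.diff_comb_mem_tangentPlane hp c d) (h.lor_diff_comb_comm hp a b c d) hmix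
    (fun _ => h.eq_zero_of_diff_comb hp hpair hdet) hsing

end LegendrianOn

end legendrian

/-! ### Conformal coordinates from an immersion into the light cone -/

section lightcone

/-- Stereographic parametrization of a section of the light cone, from one of the two poles
`s = ±1`. -/
def sig (s : ℝ) (z : ℂ) : R41 :=
  ![(z.re ^ 2 + z.im ^ 2 + 1) / 2, z.re, z.im, s * ((z.re ^ 2 + z.im ^ 2 + -1) / 2)]

/-- The differential of `sig s` at `z`. -/
def dsig (s : ℝ) (z : ℂ) : ℂ →L[ℝ] R41 :=
  ContinuousLinearMap.pi ![z.re • Complex.reCLM + z.im • Complex.imCLM, Complex.reCLM,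
    Complex.imCLM, s • (z.re • Complex.reCLM + z.im • Complex.imCLM)]

/-- The coordinate for which a lightlike vector `x` is a multiple of `sig s (stereo s x)`. -/
def stereo (s : ℝ) (x : R41) : ℂ :=
  Complex.equivRealProdCLM.symm (x 1 / (x 0 - s * x 3), x 2 / (x 0 - s * x 3))

variable {s : ℝ}

lemma hasFDerivAt_sig (s : ℝ) (z : ℂ) : HasFDerivAt (sig s) (dsig s z) z := by
  have hre : HasFDerivAt Complex.re Complex.reCLM z := Complex.reCLM.hasFDerivAt
  have him : HasFDerivAt Complex.im Complex.imCLM z := Complex.imCLM.hasFDerivAt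
  have hsq (r : ℝ) : HasFDerivAt (fun x : ℂ => (x.re ^ 2 + x.im ^ 2 + r) / 2)
      (z.re • Complex.reCLM + z.im • Complex.imCLM) z := by
    refine ((((hre.pow 2).add (him.pow 2)).add_const r).mul_const 2⁻¹).congr_fderiv ?_
    ext c
    simp only [Nat.add_one_sub_one, pow_one, nsmul_eq_mul, Nat.cast_ofNat, add_apply, smul_apply,
      Complex.reCLM_apply, Complex.imCLM_apply, smul_eq_mul]
    ring
  rw [hasFDerivAt_pi']
  intro i
  fin_cases i
  · exact hsq 1
  · exact hre
  · exact him
  · exact (hsq (-1)).const_mul s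

lemma dsig_apply (s : ℝ) (z c : ℂ) : dsig s z c =
    ![z.re * c.re + z.im * c.im, c.re, c.im, s * (z.re * c.re + z.im * c.im)] := by
  ext i
  fin_cases i <;> simp [dsig, mul_add]

lemma lor_sig (hs : s * s = 1) (z : ℂ) : lor (sig s z) (sig s z) = 0 := by
  simp only [lor, sig, Matrix.cons_val_zero, Matrix.cons_val_one, Matrix.cons_val]
  linear_combination (z.re ^ 2 + z.im ^ 2 - 1) ^ 2 / 4 * hs

lemma lor_sig_dsig (hs : s * s = 1) (z c : ℂ) : lor (sig s z) (dsig s z c) = 0 := by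
  simp only [lor, sig, dsig_apply, Matrix.cons_val_zero, Matrix.cons_val_one, Matrix.cons_val]
  linear_combination (z.re ^ 2 + z.im ^ 2 - 1) / 2 * (z.re * c.re + z.im * c.im) * hs

lemma lor_dsig (hs : s * s = 1) (z c d : ℂ) :
    lor (dsig s z c) (dsig s z d) = c.re * d.re + c.im * d.im := by
  simp only [lor, dsig_apply, Matrix.cons_val_zero, Matrix.cons_val_one, Matrix.cons_val]
  linear_combination (z.re * c.re + z.im * c.im) * (z.re * d.re + z.im * d.im) * hs

lemma lor_smul_sig_add_smul_dsig (hs : s * s = 1) (z c d : ℂ) (k l r : ℝ) :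
    lor (k • sig s z + r • dsig s z c) (l • sig s z + r • dsig s z d) =
      r ^ 2 * (c.re * d.re + c.im * d.im) := by
  simp only [lor_add_left, lor_add_right, lor_smul_left, lor_smul_right, lor_sig hs,
    lor_sig_dsig hs, lor_dsig hs, lor_comm (dsig s z c) (sig s z)]
  ring

lemma eq_smul_sig_stereo (hs : s * s = 1) {x : R41} (hx : lor x x = 0)
    (h0 : x 0 - s * x 3 ≠ 0) : x = (x 0 - s * x 3) • sig s (stereo s x) := by
  unfold stereo
  set k := x 0 - s * x 3 with hk
  have hnorm : (x 1 / k) ^ 2 + (x 2 / k) ^ 2 = (x 0 + s * x 3) / k := by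
    simp only [lor] at hx
    field_simp
    linear_combination hx + x 3 ^ 2 * hs - (x 0 + s * x 3) * hk
  funext i
  fin_cases i <;> simp [sig, hnorm] <;> field_simp
  · linear_combination -hk
  · linear_combination s * hk - 2 * x 3 * hs

lemma exists_sign_ne_zero {x : R41} (hx : lor x x = 0) (hx0 : x ≠ 0) :
    ∃ s : ℝ, s * s = 1 ∧ x 0 - s * x 3 ≠ 0 := by
  by_contra! hpole
  have hminus := hpole 1 (by norm_num)
  have hplus := hpole (-1) (by norm_num)
  have h0 : x 0 = 0 := by linarith
  have h3 : x 3 = 0 := by linarith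
  simp only [lor, h0, h3] at hx
  have h1 : x 1 = 0 := by nlinarith [sq_nonneg (x 1), sq_nonneg (x 2)]
  have h2 : x 2 = 0 := by nlinarith [sq_nonneg (x 1), sq_nonneg (x 2)]
  exact hx0 (funext fun i => by fin_cases i <;> assumption)

lemma contDiffOn_stereo (s : ℝ) : ContDiffOn ℝ ∞ (stereo s) {x | x 0 - s * x 3 ≠ 0} :=
  Complex.equivRealProdCLM.symm.contDiff.comp_contDiffOn
    (ContDiffOn.prodMk (ContDiffOn.div (by fun_prop) (by fun_prop) fun _ hx => hx)
      (ContDiffOn.div (by fun_prop) (by fun_prop) fun _ hx => hx))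

lemma isOpen_stereo_domain (s : ℝ) : IsOpen {x : R41 | x 0 - s * x 3 ≠ 0} :=
  isOpen_ne_fun (by fun_prop) continuous_const

lemma pd_smul_sig {L : ℂ → ℝ} {w : ℂ} (hL : DifferentiableAt ℝ L w) (c : ℂ) :
    pd (fun x => L x • sig s x) c w = pd L c w • sig s w + L w • dsig s w c := by
  have hprod := (hL.hasFDerivAt.smul (hasFDerivAt_sig s w)).fderiv
  exact (congrArg (fun A : ℂ →L[ℝ] R41 => A c) hprod).trans (add_comm _ _)

variable {M : Type*} [TopologicalSpace M] [ChartedSpace (EuclideanSpace ℝ (Fin 2)) M]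
  {G : M → R41} {U : Set M} {p : M}

/-- A variation which keeps the stereographic coordinate fixed is tangent to a ray of the light
cone. -/
lemma injective_mfderiv_stereo (hs : s * s = 1) (hU : IsOpen U)
    (hG : ContMDiffOn (𝓡 2) 𝓘(ℝ, R41) ∞ G U) (hnull : ∀ q ∈ U, lor (G q) (G q) = 0)
    (hp : p ∈ U) (hdG : ∀ v, lor (diff G p v) (diff G p v) = 0 → v = 0)
    (h0 : G p 0 - s * G p 3 ≠ 0) :
    Function.Injective (mfderiv (𝓡 2) 𝓘(ℝ, ℂ) (stereo s ∘ G) p) := by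
  have hGp := mdifferentiableAt_of_contMDiffOn hU hG hp
  have hL : Differentiable ℝ fun x : R41 => x 0 - s * x 3 := by fun_prop
  have hst : DifferentiableAt ℝ (stereo s) (G p) :=
    ((contDiffOn_stereo s).contDiffAt ((isOpen_stereo_domain s).mem_nhds h0)).differentiableAt
      (by simp)
  set Φ : R41 → R41 := fun x => (x 0 - s * x 3) • sig s (stereo s x)
  have hΦ : HasFDerivAt Φ _ (G p) :=
    (hL (G p)).hasFDerivAt.smul ((hasFDerivAt_sig s _).comp (G p) hst.hasFDerivAt)
  have hG_eq : G =ᶠ[𝓝 p] Φ ∘ G := by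
    filter_upwards [hU.mem_nhds hp,
      hGp.continuousAt.eventually ((isOpen_stereo_domain s).mem_nhds h0)] with q hq hq0
    exact eq_smul_sig_stereo hs (hnull q hq) hq0
  have hdG_eq : diff G p = fderiv ℝ Φ (G p) ∘L diff G p :=
    hG_eq.mfderiv_eq.trans ((mfderiv_comp p hΦ.differentiableAt.mdifferentiableAt hGp).trans
      (congrArg (fun A : R41 →L[ℝ] R41 => A ∘L diff G p) mfderiv_eq_fderiv))
  refine (injective_iff_map_eq_zero _).2 fun v hv => hdG v ?_
  have hz : fderiv ℝ (stereo s) (G p) (diff G p v) = 0 := by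
    rw [mfderiv_comp p hst.mdifferentiableAt hGp, mfderiv_eq_fderiv] at hv
    exact hv
  have hray : diff G p v =
      (G p 0 - s * G p 3) • dsig s (stereo s (G p)) (fderiv ℝ (stereo s) (G p) (diff G p v)) +
        fderiv ℝ (fun x : R41 => x 0 - s * x 3) (G p) (diff G p v) • sig s (stereo s (G p)) :=
    congrArg (fun A => A v) (hdG_eq.trans (congrArg (· ∘L diff G p) hΦ.fderiv))
  rw [hz, map_zero, smul_zero, zero_add] at hray
  rw [hray, lor_smul_left, lor_smul_right, lor_sig hs, mul_zero, mul_zero]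

variable [IsManifold (𝓡 2) ∞ M]

/-- The stereographic projection of the light cone provides the coordinate. -/
lemma exists_conformal_param (hU : IsOpen U) (hG : ContMDiffOn (𝓡 2) 𝓘(ℝ, R41) ∞ G U)
    (hnull : ∀ q ∈ U, lor (G q) (G q) = 0) (hp : p ∈ U) (hGp : G p ≠ 0)
    (hdG : ∀ v, lor (diff G p v) (diff G p v) = 0 → v = 0) :
    ∃ e : OpenPartialHomeomorph M ℂ, IsParam e ∧ p ∈ e.source ∧ e.source ⊆ U ∧
      IsConformalOn (G ∘ e.symm) e.target ∧
      ∀ w ∈ e.target, lor (pd (G ∘ e.symm) 1 w) (pd (G ∘ e.symm) 1 w) ≠ 0 := by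
  obtain ⟨s, hs, h0⟩ := exists_sign_ne_zero (hnull p hp) hGp
  set U₁ := U ∩ G ⁻¹' {x | x 0 - s * x 3 ≠ 0}
  have hU₁ : IsOpen U₁ := hG.continuousOn.isOpen_inter_preimage hU (isOpen_stereo_domain s)
  have hstereo : ContMDiffOn (𝓡 2) 𝓘(ℝ, ℂ) ∞ (stereo s ∘ G) U₁ :=
    (contDiffOn_stereo s).contMDiffOn.comp (hG.mono Set.inter_subset_left) fun _ hq => hq.2
  obtain ⟨e, he, hpe, heU₁, hez⟩ := exists_param_of_injective hU₁ ⟨hp, h0⟩ hstereo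
    (injective_mfderiv_stereo hs hU hG hnull hp hdG h0)
  set L : ℂ → ℝ := fun w => G (e.symm w) 0 - s * G (e.symm w) 3
  have hΓ_smooth := he.contDiffOn_comp_symm hG fun q hq => (heU₁ hq).1
  have hL_smooth : ContDiffOn ℝ ∞ L e.target :=
    ContDiff.comp_contDiffOn (g := fun x : R41 => x 0 - s * x 3) (by fun_prop) hΓ_smooth
  have hΓ_eq : Set.EqOn (G ∘ e.symm) (fun w => L w • sig s w) e.target := fun w hw => by
    have hq := heU₁ (e.map_target hw)
    have hz : stereo s (G (e.symm w)) = w := (hez (e.map_target hw)).symm.trans (e.right_inv hw)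
    have hcone := eq_smul_sig_stereo hs (hnull _ hq.1) hq.2
    rwa [hz] at hcone
  have hmetric (w : ℂ) (hw : w ∈ e.target) (c d : ℂ) :
      lor (pd (G ∘ e.symm) c w) (pd (G ∘ e.symm) d w) = L w ^ 2 * (c.re * d.re + c.im * d.im) := by
    have hLw := differentiableAt_of_contDiffOn e.open_target hL_smooth hw
    rw [pd_congr e.open_target hw hΓ_eq, pd_congr e.open_target hw hΓ_eq, pd_smul_sig hLw,
      pd_smul_sig hLw, lor_smul_sig_add_smul_dsig hs]
  refine ⟨e, he, hpe, fun q hq => (heU₁ hq).1, fun w hw => ?_, fun w hw => ?_⟩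
  · simp [hmetric w hw]
  · simpa [hmetric w hw] using (heU₁ (e.map_target hw)).2

end lightcone

section gauss

variable {M : Type*} [TopologicalSpace M] [ChartedSpace (EuclideanSpace ℝ (Fin 2)) M]
  [IsManifold (𝓡 2) ∞ M] {f ν : M → R41} {U : Set M} {p : M}

namespace LegendrianOn

/-- The lightlike Gauss map `f + ν` makes the surface a Riemann surface near its regular points. -/
lemma exists_gauss_conformal_param (h : LegendrianOn f ν U) (hp : p ∈ U)
    (hreg : IsRegularPt (comb 1 1 f ν) p) :
    ∃ e : OpenPartialHomeomorph M ℂ, IsParam e ∧ p ∈ e.source ∧ e.source ⊆ U ∧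
      IsConformalOn (comb 1 1 f ν ∘ e.symm) e.target ∧ ∀ w ∈ e.target,
        lor (pd (comb 1 1 f ν ∘ e.symm) 1 w) (pd (comb 1 1 f ν ∘ e.symm) 1 w) ≠ 0 := by
  have hframe := h.normalFrame p hp
  refine exists_conformal_param h.isOpen (h.smooth_comb 1 1) (fun q hq => ?_) hp
    (fun hzero => ?_) fun v hv => ?_
  · rw [h.lor_comb hq, sub_self]
  · have := h.lor_comb hp 1 0 1 1
    rw [hzero, lor_zero_right] at this
    norm_num at this
  · exact (injective_iff_map_eq_zero _).1 hreg v
      (eq_zero_of_lor_self hframe.lor_self (h.diff_comb_mem_tangentPlane hp 1 1 v).1 hv)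

lemma isTraceFreeAt_comb (h : LegendrianOn f ν U) {e : OpenPartialHomeomorph M ℂ}
    (he : IsParam e) (heU : e.source ⊆ U) {w : ℂ} (hw : w ∈ e.target) {a b : ℝ}
    (hconf : IsConformalOn (comb 1 1 f ν ∘ e.symm) e.target)
    (h0 : lor (pd (comb 1 1 f ν ∘ e.symm) 1 w) (pd (comb 1 1 f ν ∘ e.symm) 1 w) ≠ 0)
    (hmix : MixedAreaZero f ν 1 1 a b (e.symm w)) :
    IsTraceFreeAt (comb 1 1 f ν ∘ e.symm) (comb a b f ν ∘ e.symm) w := by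
  have hq := heU (e.map_target hw)
  have hmem (r s : ℝ) (c : ℂ) :
      pd (comb r s f ν ∘ e.symm) c w ∈ tangentPlane (f (e.symm w)) (ν (e.symm w)) :=
    h.pd_comb he heU hw r s c ▸ h.diff_comb_mem_tangentPlane hq r s _
  refine (h.normalFrame _ hq).exists_trace_free (hmem 1 1 1) (hmem 1 1 Complex.I) (hmem a b 1)
    (hmem a b Complex.I) (hconf w hw).2 (hconf w hw).1
    (fun hzero => h0 (by rw [hzero, lor_zero_left])) ?_ ?_ <;>
    simp only [h.pd_comb he heU hw]
  · exact h.lor_diff_comb_comm hq a b 1 1 _ _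
  · exact hmix _ _

/-- The zeros are those of the Hopf differential of `d(a f + b ν)` relative to `d(f + ν)`. -/
theorem diff_comb_eq_zero_or_isolated (h : LegendrianOn f ν U) (hp : p ∈ U) {a b : ℝ}
    (hmix : ∀ q ∈ U, MixedAreaZero f ν 1 1 a b q) (hreg : IsRegularPt (comb 1 1 f ν) p) :
    (∀ᶠ q in 𝓝 p, diff (comb a b f ν) q = 0) ∨
      ∀ᶠ q in 𝓝[≠] p, diff (comb a b f ν) q ≠ 0 := by
  obtain ⟨e, he, hpe, heU, hconf, hΓ0⟩ := h.exists_gauss_conformal_param hp hreg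
  set Γ := comb 1 1 f ν ∘ e.symm
  set Δ := comb a b f ν ∘ e.symm
  have htrace (w : ℂ) (hw : w ∈ e.target) : IsTraceFreeAt Γ Δ w :=
    h.isTraceFreeAt_comb he heU hw hconf (hΓ0 w hw) (hmix _ (heU (e.map_target hw)))
  have hholo := differentiableOn_hopf e.open_target (he.contDiffOn_comp_symm (h.smooth_comb 1 1)
    heU) (he.contDiffOn_comp_symm (h.smooth_comb a b) heU) hconf htrace
  have hzero (q : M) (hq : q ∈ e.source) : hopf Γ Δ (e q) = 0 ↔ diff (comb a b f ν) q = 0 := by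
    have hw := e.map_source hq
    rw [(htrace _ hw).hopf_eq_zero_iff hconf hw (hΓ0 _ hw), ContinuousLinearMap.ext_iff]
    simp only [Δ, h.pd_comb he heU hw, e.left_inv hq]
    exact ((he.frame_surjective hw).forall (p := fun v => diff (comb a b f ν) q v = 0)).symm
  have hsource := e.open_source.eventually_mem hpe
  rcases (hholo.analyticAt (e.open_target.mem_nhds
    (e.map_source hpe))).eventually_eq_zero_or_eventually_ne_zero with hall | hisolated
  · left
    filter_upwards [(e.continuousAt hpe).eventually hall, hsource] with q hq hqe
    exact (hzero q hqe).1 hq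
  · right
    rw [eventually_nhdsWithin_iff] at hisolated ⊢
    filter_upwards [(e.continuousAt hpe).eventually hisolated, hsource] with q hq hqe hne
    exact fun hD => hq (fun heq => hne (e.injOn hqe hpe heq)) ((hzero q hqe).2 hD)

end LegendrianOn

end gauss

/-! ### Pairs of focal surfaces -/

section focal

variable {A B : ℂ → R41} {T : Set ℂ} {w : ℂ}

lemma pd_pd_eq_zero {c : ℂ} (hT : IsOpen T) (hA : ContDiffOn ℝ ∞ A T)
    (hAc : ∀ x ∈ T, pd A c x = 0) (d : ℂ) : ∀ x ∈ T, pd (pd A d) c x = 0 := fun x hx => by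
  rw [pd_comm hT hA hx, pd_congr hT hx hAc, pd_const]

lemma lor_pd_eq_zero {c : ℂ} {k : ℝ} (hT : IsOpen T) (hA : ContDiffOn ℝ ∞ A T)
    (hB : ContDiffOn ℝ ∞ B T) (hBc : ∀ x ∈ T, pd B c x = 0) (hk : ∀ x ∈ T, lor (A x) (B x) = k) :
    ∀ x ∈ T, lor (pd A c x) (B x) = 0 := fun x hx => by
  simpa [hBc x hx] using lor_pd_add_lor_pd hT hA hB hk hx c

lemma lor_pd_self {c : ℂ} {k : ℝ} (hT : IsOpen T) (hA : ContDiffOn ℝ ∞ A T)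
    (hk : ∀ x ∈ T, lor (A x) (A x) = k) : ∀ x ∈ T, lor (pd A c x) (A x) = 0 := fun x hx => by
  have := lor_pd_add_lor_pd hT hA hA hk hx c
  rw [lor_comm (A x)] at this
  linarith

lemma linearIndependent_of_lor {a b u u' v v' : R41} (hab : lor a b ≠ 0) (hu : lor u u ≠ 0)
    (hv : lor v v ≠ 0) (hua : lor u a = 0) (hub : lor u b = 0) (hu'a : lor u' a + lor u u = 0)
    (hu'b : lor u' b = 0) (hva : lor v a = 0) (hvb : lor v b = 0) (hvu : lor v u = 0)
    (hvu' : lor v u' = 0) (hv'a : lor v' a = 0) (hv'b : lor v' b + lor v v = 0)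
    (hv'u : lor v' u = 0) (hv'u' : lor v' u' = 0) : LinearIndependent ℝ ![a, b, u, v, u'] := by
  refine Fintype.linearIndependent_iff.2 fun g hg => ?_
  have hpair (y : R41) : g 0 * lor a y + g 1 * lor b y + g 2 * lor u y + g 3 * lor v y +
      g 4 * lor u' y = 0 := by
    simpa [Fin.sum_univ_five] using congrArg (lor · y) hg
  have h3 : g 3 = 0 := by
    simpa [lor_comm _ v, hva, hvb, hvu, hvu', hv] using hpair v
  have h1 : g 1 = 0 := by
    simpa [lor_comm _ v', hv'a, hv'u, hv'u', h3, eq_neg_of_add_eq_zero_left hv'b, hv]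
      using hpair v'
  have h0 : g 0 = 0 := by simpa [h1, h3, hub, hu'b, hab] using hpair b
  have h4 : g 4 = 0 := by
    simpa [h0, h1, h3, hua, eq_neg_of_add_eq_zero_left hu'a, hu] using hpair a
  have h2 : g 2 = 0 := by simpa [h0, h1, h3, h4, hu] using hpair u
  intro i
  fin_cases i <;> assumption

/-- If `⟨A, B⟩ ≠ 0`, then `A`, `B`, `A_y`, `B_x`, `A_yy` would be linearly independent in `ℝ⁴`. -/
lemma lor_eq_zero_of_separated {α β k : ℝ} (hT : IsOpen T) (hA : ContDiffOn ℝ ∞ A T)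
    (hB : ContDiffOn ℝ ∞ B T) (hAx : ∀ x ∈ T, pd A 1 x = 0) (hBy : ∀ x ∈ T, pd B Complex.I x = 0)
    (hAA : ∀ x ∈ T, lor (A x) (A x) = α) (hBB : ∀ x ∈ T, lor (B x) (B x) = β)
    (hAB : ∀ x ∈ T, lor (A x) (B x) = k) (hw : w ∈ T)
    (hAy : lor (pd A Complex.I w) (pd A Complex.I w) ≠ 0) (hBx : lor (pd B 1 w) (pd B 1 w) ≠ 0) :
    k = 0 := by
  have hA' := contDiffOn_pd hT hA Complex.I
  have hA'' := contDiffOn_pd hT hA' Complex.I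
  have hB' := contDiffOn_pd hT hB 1
  have hA'x := pd_pd_eq_zero hT hA hAx Complex.I
  have hA''x := pd_pd_eq_zero hT hA' hA'x Complex.I
  have hA'A := lor_pd_self (c := Complex.I) hT hA hAA
  have hB'B := lor_pd_self (c := 1) hT hB hBB
  have hA'B := lor_pd_eq_zero hT hA hB hBy hAB
  have hA''B := lor_pd_eq_zero hT hA' hB hBy hA'B
  have hB'A := lor_pd_eq_zero hT hB hA hAx fun x hx => (lor_comm _ _).trans (hAB x hx)
  have hB'A' := lor_pd_eq_zero hT hB hA' hA'x fun x hx => (lor_comm _ _).trans (hA'B x hx)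
  have hB'A'' := lor_pd_eq_zero hT hB hA'' hA''x fun x hx => (lor_comm _ _).trans (hA''B x hx)
  have hB''A := lor_pd_eq_zero hT hB' hA hAx hB'A w hw
  have hB''A' := lor_pd_eq_zero hT hB' hA' hA'x hB'A' w hw
  have hB''A'' := lor_pd_eq_zero hT hB' hA'' hA''x hB'A'' w hw
  have hA''A := lor_pd_add_lor_pd hT hA' hA hA'A hw Complex.I
  have hB''B := lor_pd_add_lor_pd hT hB' hB hB'B hw 1
  by_contra hk
  have hindep := linearIndependent_of_lor (hAB w hw ▸ hk) hAy hBx (hA'A w hw) (hA'B w hw) hA''A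
    (hA''B w hw) (hB'A w hw) (hB'B w hw) (hB'A' w hw) (hB'A'' w hw) hB''A hB''B hB''A' hB''A''
  simpa using hindep.fintype_card_le_finrank

/-- The kernels of `L` and of its `i`-th component are both lines, and one contains the other. -/
lemma eq_zero_of_apply_eq_zero {V : Type*} [AddCommGroup V] [Module ℝ V]
    (hV : Module.finrank ℝ V = 2) {L : V →ₗ[ℝ] R41} {i : Fin 4} (hker : ∃ v ≠ 0, L v = 0)
    (hi : ∃ v, L v i ≠ 0) {v : V} (hv : L v i = 0) : L v = 0 := by
  have : FiniteDimensional ℝ V := Module.finite_of_finrank_pos (by omega)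
  obtain ⟨v₀, hv₀, hLv₀⟩ := hker
  obtain ⟨v₁, hv₁⟩ := hi
  set l : V →ₗ[ℝ] ℝ := LinearMap.proj i ∘ₗ L
  have hle : L.ker ≤ l.ker := LinearMap.ker_le_ker_comp L _
  have hL : 1 ≤ Module.finrank ℝ L.ker :=
    Submodule.one_le_finrank_iff.2 ((Submodule.ne_bot_iff _).2 ⟨v₀, hLv₀, hv₀⟩)
  have hl : Module.finrank ℝ l.ker ≤ 1 := by
    have hlt : Module.finrank ℝ l.ker < 2 := by
      simpa [hV] using Submodule.finrank_lt (s := l.ker)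
        fun htop => hv₁ (LinearMap.congr_fun (LinearMap.ker_eq_top.1 htop) v₁)
    omega
  exact (Submodule.eq_of_le_of_finrank_le hle (hl.trans hL)).ge hv

lemma exists_apply_injective {V : Type*} [AddCommGroup V] [Module ℝ V]
    (hV : Module.finrank ℝ V = 2) {A B : V →ₗ[ℝ] R41} (hA : ∃ v ≠ 0, A v = 0)
    (hB : ∃ v ≠ 0, B v = 0) (hjoint : ∀ v, A v = 0 → B v = 0 → v = 0) :
    ∃ i j, ∀ v, A v i = 0 → B v j = 0 → v = 0 := by
  obtain ⟨u, hu, hAu⟩ := hA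
  obtain ⟨v, hv, hBv⟩ := hB
  obtain ⟨i, hi⟩ := Function.ne_iff.1 fun h0 => hv (hjoint v h0 hBv)
  obtain ⟨j, hj⟩ := Function.ne_iff.1 fun h0 => hu (hjoint u hAu h0)
  exact ⟨i, j, fun x hxi hxj => hjoint x
    (eq_zero_of_apply_eq_zero hV ⟨u, hu, hAu⟩ ⟨v, hi⟩ hxi)
    (eq_zero_of_apply_eq_zero hV ⟨v, hv, hBv⟩ ⟨u, hj⟩ hxj)⟩

lemma pd_eq_zero_of_apply_eq {i : Fin 4} (l : ℂ →L[ℝ] ℝ) {c d : ℂ} (hT : IsOpen T)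
    (hA : ContDiffOn ℝ ∞ A T) (hAl : ∀ x ∈ T, A x i = l x) (hw : w ∈ T)
    (hker : ∃ v ≠ 0, pd A v w = 0) (hc : l c ≠ 0) (hd : l d = 0) : pd A d w = 0 := by
  have hpd (v : ℂ) : pd A v w i = l v := by
    have hAi := (hasFDerivAt_pi'.1 (differentiableAt_of_contDiffOn hT hA hw).hasFDerivAt i).fderiv
    calc pd A v w i = pd (fun x => A x i) v w := (congrArg (fun B => B v) hAi).symm
      _ = l v := by rw [pd_congr hT hw hAl, pd, l.fderiv]
  exact eq_zero_of_apply_eq_zero Complex.finrank_real_complex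
    (L := (fderiv ℝ A w).toLinearMap) hker ⟨c, (hpd c).trans_ne hc⟩ ((hpd d).trans hd)

variable {M : Type*} [TopologicalSpace M] [ChartedSpace (EuclideanSpace ℝ (Fin 2)) M]
  [IsManifold (𝓡 2) ∞ M] {g h : M → R41} {U : Set M} {p : M}

/-- Maps of rank one with transverse kernels each depend on one coordinate of a suitable
parametrization. -/
lemma exists_separating_param (hU : IsOpen U) (hp : p ∈ U)
    (hg : ContMDiffOn (𝓡 2) 𝓘(ℝ, R41) ∞ g U) (hh : ContMDiffOn (𝓡 2) 𝓘(ℝ, R41) ∞ h U)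
    (hg_ker : ∀ q ∈ U, ∃ v ≠ 0, diff g q v = 0) (hh_ker : ∀ q ∈ U, ∃ v ≠ 0, diff h q v = 0)
    (hjoint : ∀ v, diff g p v = 0 → diff h p v = 0 → v = 0) :
    ∃ e : OpenPartialHomeomorph M ℂ, IsParam e ∧ p ∈ e.source ∧ e.source ⊆ U ∧
      ∀ w ∈ e.target, pd (g ∘ e.symm) 1 w = 0 ∧ pd (h ∘ e.symm) Complex.I w = 0 := by
  obtain ⟨i, j, hij⟩ := exists_apply_injective (A := (diff g p).toLinearMap)
    (B := (diff h p).toLinearMap) (by simp) (hg_ker p hp) (hh_ker p hp) hjoint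
  let P : R41 →L[ℝ] ℂ := Complex.ofRealCLM ∘L ContinuousLinearMap.proj j
  let Q : R41 →L[ℝ] ℂ := (Complex.I • Complex.ofRealCLM) ∘L ContinuousLinearMap.proj i
  set z : M → ℂ := P ∘ h + Q ∘ g
  have hz : ContMDiffOn (𝓡 2) 𝓘(ℝ, ℂ) ∞ z U :=
    (P.contDiff.contMDiff.comp_contMDiffOn hh).add (Q.contDiff.contMDiff.comp_contMDiffOn hg)
  have hdz (v : EuclideanSpace ℝ (Fin 2)) :
      mfderiv (𝓡 2) 𝓘(ℝ, ℂ) z p v = P (diff h p v) + Q (diff g p v) :=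
    congrArg (fun A => A v) ((P.hasMFDerivAt.comp p
      (mdifferentiableAt_of_contMDiffOn hU hh hp).hasMFDerivAt).add (Q.hasMFDerivAt.comp p
        (mdifferentiableAt_of_contMDiffOn hU hg hp).hasMFDerivAt)).mfderiv
  obtain ⟨e, he, hpe, heU, hez⟩ := exists_param_of_injective hU hp hz <|
    (injective_iff_map_eq_zero _).2 fun v hv => by
      have hsum : P (diff h p v) + Q (diff g p v) = 0 := (hdz v).symm.trans hv
      have hcomponents : diff h p v j = 0 ∧ diff g p v i = 0 := by
        simpa [P, Q, Complex.ext_iff] using hsum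
      exact hij v hcomponents.2 hcomponents.1
  have hcoord (w : ℂ) (hw : w ∈ e.target) :
      h (e.symm w) j = w.re ∧ g (e.symm w) i = w.im := by
    have hzw : z (e.symm w) = w := (hez (e.map_target hw)).symm.trans (e.right_inv hw)
    simpa [z, P, Q, Complex.ext_iff] using hzw
  refine ⟨e, he, hpe, heU, fun w hw => ⟨?_, ?_⟩⟩
  · exact pd_eq_zero_of_apply_eq Complex.imCLM (c := Complex.I) e.open_target
      (he.contDiffOn_comp_symm hg heU) (fun x hx => (hcoord x hx).2) hw
      (he.exists_pd_eq_zero hU hg heU hw (hg_ker _ (heU (e.map_target hw)))) (by simp) (by simp)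
  · exact pd_eq_zero_of_apply_eq Complex.reCLM (c := 1) e.open_target
      (he.contDiffOn_comp_symm hh heU) (fun x hx => (hcoord x hx).1) hw
      (he.exists_pd_eq_zero hU hh heU hw (hh_ker _ (heU (e.map_target hw)))) (by simp) (by simp)

namespace LegendrianOn

variable {f ν : M → R41}

/-- Focal surfaces of constant radius are orthogonal as maps to Lorentz-Minkowski space. -/
theorem lor_comb_eq_zero_of_singular (h : LegendrianOn f ν U) (hp : p ∈ U)
    (hpair : ∀ v, diff f p v = 0 → diff ν p v = 0 → v = 0) {a b c d : ℝ}
    (hdet : a * d - b * c ≠ 0) (hab : ∀ q ∈ U, ¬ IsRegularPt (comb a b f ν) q)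
    (hcd : ∀ q ∈ U, ¬ IsRegularPt (comb c d f ν) q) : b * d = a * c := by
  obtain ⟨e, he, hpe, heU, hsep⟩ := exists_separating_param h.isOpen hp (h.smooth_comb a b)
    (h.smooth_comb c d) (fun q hq => exists_ne_zero_of_not_injective (hab q hq))
    (fun q hq => exists_ne_zero_of_not_injective (hcd q hq))
    fun v => h.eq_zero_of_diff_comb hp hpair hdet
  obtain ⟨w, hw, rfl⟩ : ∃ w ∈ e.target, e.symm w = p := ⟨e p, e.map_source hpe, e.left_inv hpe⟩
  have hspacelike {r s : ℝ} {y : ℂ}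
      (hzero : lor (pd (comb r s f ν ∘ e.symm) y w) (pd (comb r s f ν ∘ e.symm) y w) = 0) :
      pd (comb r s f ν ∘ e.symm) y w = 0 :=
    eq_zero_of_lor_self (h.normalFrame _ hp).lor_self
      (h.pd_comb he heU hw r s y ▸ (h.diff_comb_mem_tangentPlane hp r s _).1) hzero
  have hinj {y : ℂ} (hA : pd (comb a b f ν ∘ e.symm) y w = 0)
      (hB : pd (comb c d f ν ∘ e.symm) y w = 0) : y = 0 := by
    rw [h.pd_comb he heU hw] at hA hB
    exact (map_eq_zero_iff _ (he.frame_injective hw)).1 (h.eq_zero_of_diff_comb hp hpair hdet hA hB)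
  have hlor (r s t u : ℝ) (x : ℂ) (hx : x ∈ e.target) :
      lor (comb r s f ν (e.symm x)) (comb t u f ν (e.symm x)) = s * u - r * t :=
    h.lor_comb (heU (e.map_target hx)) r s t u
  exact sub_eq_zero.1 (lor_eq_zero_of_separated e.open_target
    (he.contDiffOn_comp_symm (h.smooth_comb a b) heU)
    (he.contDiffOn_comp_symm (h.smooth_comb c d) heU) (fun x hx => (hsep x hx).1)
    (fun x hx => (hsep x hx).2) (hlor a b a b) (hlor c d c d) (hlor a b c d) hw
    (fun h0 => Complex.I_ne_zero (hinj (hspacelike h0) (hsep w hw).2))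
    fun h0 => one_ne_zero (hinj (hsep w hw).1 (hspacelike h0)))

end LegendrianOn

end focal

/-! ### Curvature and mixed areas -/

section curvature

variable {M : Type*} [TopologicalSpace M] [ChartedSpace (EuclideanSpace ℝ (Fin 2)) M]
  {f ν g m : M → R41} {U : Set M} {p : M} {x n : R41}

namespace NormalFrame

lemma area_ne_zero (h : NormalFrame x n) (hg : ∀ v, diff g p v ∈ tangentPlane x n)
    (hreg : IsRegularPt g p) : area x n (diff g p (tbasis 0)) (diff g p (tbasis 1)) ≠ 0 :=
  fun h0 => (h.not_injective_iff hg).2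
    (mixedArea_eq_zero_of_span span_tbasis (by rw [mixedArea_self, h0, mul_zero])) hreg

lemma firstForm_det (h : NormalFrame x n) (hg : ∀ v, diff g p v ∈ tangentPlane x n) :
    (firstForm g p).det = area x n (diff g p (tbasis 0)) (diff g p (tbasis 1)) ^ 2 := by
  rw [sq, h.area_mul_area (hg _) (hg _) (hg _) (hg _), Matrix.det_fin_two]
  rfl

lemma secondForm_det (h : NormalFrame x n) (hg : ∀ v, diff g p v ∈ tangentPlane x n)
    (hm : ∀ v, diff m p v ∈ tangentPlane x n) :
    (secondForm g m p).det = area x n (diff g p (tbasis 0)) (diff g p (tbasis 1)) *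
      area x n (diff m p (tbasis 0)) (diff m p (tbasis 1)) := by
  rw [h.area_mul_area (hg _) (hg _) (hm _) (hm _), Matrix.det_fin_two]
  simp only [secondForm, Matrix.of_apply, neg_mul_neg]

lemma meanCurv_eq (h : NormalFrame x n) (hg : ∀ v, diff g p v ∈ tangentPlane x n)
    (hm : ∀ v, diff m p v ∈ tangentPlane x n) (hreg : IsRegularPt g p) :
    meanCurv g m p = -mixedArea x n (diff g p) (diff m p) (tbasis 0) (tbasis 1) /
      (2 * area x n (diff g p (tbasis 0)) (diff g p (tbasis 1))) := by
  have harea := h.area_ne_zero hg hreg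
  have hgm := h.area_mul_area (hg (tbasis 0)) (hg (tbasis 1)) (hg (tbasis 0)) (hm (tbasis 1))
  have hmg := h.area_mul_area (hg (tbasis 0)) (hg (tbasis 1)) (hm (tbasis 0)) (hg (tbasis 1))
  rw [meanCurv, Matrix.inv_def, h.firstForm_det hg, Matrix.adjugate_fin_two,
    Ring.inverse_eq_inv', Matrix.smul_mul, Matrix.trace_smul, Matrix.trace_fin_two, smul_eq_mul]
  simp only [Matrix.mul_apply, Fin.sum_univ_two, firstForm, secondForm, Matrix.of_apply,
    Matrix.cons_val', Matrix.cons_val_zero, Matrix.cons_val_one, Matrix.cons_val_fin_one,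
    mixedArea]
  field_simp
  linear_combination hgm + hmg

lemma gaussCurv_eq (h : NormalFrame x n) (hg : ∀ v, diff g p v ∈ tangentPlane x n)
    (hm : ∀ v, diff m p v ∈ tangentPlane x n) (hreg : IsRegularPt g p) :
    gaussCurv g m p = -1 + area x n (diff m p (tbasis 0)) (diff m p (tbasis 1)) /
      area x n (diff g p (tbasis 0)) (diff g p (tbasis 1)) := by
  have harea := h.area_ne_zero hg hreg
  rw [gaussCurv, Matrix.det_mul, Matrix.det_nonsing_inv, h.firstForm_det hg,
    h.secondForm_det hg hm, Ring.inverse_eq_inv']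
  field_simp

lemma weingarten_iff (h : NormalFrame x n) (hg : ∀ v, diff g p v ∈ tangentPlane x n)
    (hm : ∀ v, diff m p v ∈ tangentPlane x n) (hreg : IsRegularPt g p) (a b : ℝ) :
    a * (meanCurv g m p - 1) + b * gaussCurv g m p = 0 ↔
      ∀ v w, mixedArea x n (diff g p + diff m p) (-(a + b) • diff g p + b • diff m p) v w = 0 := by
  have harea := h.area_ne_zero hg hreg
  have hmix := mixedArea_combination (x := x) (n := n) 1 1 (-(a + b)) b (diff g p) (diff m p)
    (tbasis 0) (tbasis 1)
  rw [one_smul, one_smul, mixedArea_self, mixedArea_self] at hmix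
  have key : a * (meanCurv g m p - 1) + b * gaussCurv g m p =
      mixedArea x n (diff g p + diff m p) (-(a + b) • diff g p + b • diff m p)
        (tbasis 0) (tbasis 1) / (2 * area x n (diff g p (tbasis 0)) (diff g p (tbasis 1))) := by
    rw [h.meanCurv_eq hg hm hreg, h.gaussCurv_eq hg hm hreg, hmix]
    field_simp
    ring
  rw [key, div_eq_zero_iff, or_iff_left (mul_ne_zero two_ne_zero harea)]
  exact ⟨mixedArea_eq_zero_of_span span_tbasis, fun h0 => h0 _ _⟩

end NormalFrame

variable {a b c d : ℝ}

namespace LegendrianOn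

lemma mixedAreaZero_of_proportional (h : LegendrianOn f ν U) (hp : p ∈ U)
    (h0 : MixedAreaZero f ν a b c d p) {a' b' c' d' : ℝ} (r : ℝ) (hff : a' * c' = r * (a * c))
    (hfν : a' * d' + b' * c' = r * (a * d + b * c)) (hνν : b' * d' = r * (b * d)) :
    MixedAreaZero f ν a' b' c' d' p := by
  intro v w
  have := h0 v w
  rw [h.mixedArea_comb hp] at this ⊢
  rw [hff, hfν, hνν]
  linear_combination r * this

variable [IsManifold (𝓡 2) ∞ M]

lemma weingarten_comb_iff (h : LegendrianOn f ν U) (hp : p ∈ U)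
    (hreg : IsRegularPt (comb a b f ν) p) (α β : ℝ) :
    α * (meanCurv (comb a b f ν) (comb c d f ν) p - 1) +
        β * gaussCurv (comb a b f ν) (comb c d f ν) p = 0 ↔
      MixedAreaZero f ν (a + c) (b + d) (-(α + β) * a + β * c) (-(α + β) * b + β * d) p := by
  rw [(h.normalFrame p hp).weingarten_iff (h.diff_comb_mem_tangentPlane hp a b)
    (h.diff_comb_mem_tangentPlane hp c d) hreg, MixedAreaZero]
  simp only [h.diff_comb hp]
  rw [show a • diff f p + b • diff ν p + (c • diff f p + d • diff ν p) =
      (a + c) • diff f p + (b + d) • diff ν p by module,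
    show -(α + β) • (a • diff f p + b • diff ν p) + β • (c • diff f p + d • diff ν p) =
      (-(α + β) * a + β * c) • diff f p + (-(α + β) * b + β * d) • diff ν p by module]

lemma weingarten_iff (h : LegendrianOn f ν U) (hp : p ∈ U) (hreg : IsRegularPt f p) (ε : ℝ) :
    2 * ε * (meanCurv f ν p - 1) + (1 - ε) * gaussCurv f ν p = 0 ↔
      MixedAreaZero f ν 1 1 (-(1 + ε)) (1 - ε) p := by
  have := h.weingarten_comb_iff (a := 1) (b := 0) (c := 0) (d := 1) hp
    (by rwa [comb_one_zero]) (2 * ε) (1 - ε)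
  rw [comb_one_zero, comb_zero_one] at this
  convert this using 2 <;> ring

/-- Both `f_δ + ν_δ` and `f + ν` are multiples of the lightlike Gauss map. -/
lemma mixedAreaZero_of_par (h : LegendrianOn f ν U) (hp : p ∈ U) {δ α β : ℝ}
    (hreg : IsRegularPt (par δ f ν) p)
    (hlw : α * (meanCurv (par δ f ν) (par δ ν f) p - 1) +
      β * gaussCurv (par δ f ν) (par δ ν f) p = 0) :
    MixedAreaZero f ν 1 1 (-(α + β) * Real.cosh δ + β * Real.sinh δ)
      (-(α + β) * Real.sinh δ + β * Real.cosh δ) p := by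
  rw [par_eq_comb] at hreg hlw
  rw [par_normal_eq_comb, h.weingarten_comb_iff hp hreg, Real.cosh_add_sinh,
    Real.sinh_add_cosh] at hlw
  have hexp := Real.exp_ne_zero δ
  refine h.mixedAreaZero_of_proportional hp hlw (Real.exp δ)⁻¹ ?_ ?_ ?_ <;> field_simp

lemma meanCurv_par_eq_one_iff (h : LegendrianOn f ν U) (hp : p ∈ U) {δ : ℝ}
    (hreg : IsRegularPt (par δ ν f) p) :
    meanCurv (par δ ν f) (par δ f ν) p = 1 ↔
      MixedAreaZero f ν 1 1 (Real.sinh δ) (Real.cosh δ) p := by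
  have hexp := Real.exp_ne_zero δ
  rw [par_normal_eq_comb] at hreg
  have := h.weingarten_comb_iff (c := Real.cosh δ) (d := Real.sinh δ) hp hreg 1 0
  rw [← par_normal_eq_comb, ← par_eq_comb, one_mul, zero_mul, add_zero, sub_eq_zero,
    Real.sinh_add_cosh, Real.cosh_add_sinh] at this
  rw [this]
  constructor <;> intro h0
  · refine h.mixedAreaZero_of_proportional hp h0 (-(Real.exp δ)⁻¹) ?_ ?_ ?_ <;> field_simp <;> ring
  · refine h.mixedAreaZero_of_proportional hp h0 (-Real.exp δ) ?_ ?_ ?_ <;> ring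

end LegendrianOn

end curvature

/-! ### Limits of relations and uniqueness of the normal -/

section limits

lemma continuousAt_area {X : Type*} [TopologicalSpace X] {q : X} {x n a b : X → R41}
    (hx : ContinuousAt x q) (hn : ContinuousAt n q) (ha : ContinuousAt a q)
    (hb : ContinuousAt b q) : ContinuousAt (fun r => area (x r) (n r) (a r) (b r)) q := by
  have hx' := continuousAt_pi.1 hx
  have hn' := continuousAt_pi.1 hn
  have ha' := continuousAt_pi.1 ha
  have hb' := continuousAt_pi.1 hb
  simp only [area_eq]
  fun_prop

variable {M : Type*} [TopologicalSpace M] [ChartedSpace (EuclideanSpace ℝ (Fin 2)) M]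
  {f ν ν' g g' : M → R41} {U V : Set M} {p : M} {a b c d : ℝ}

lemma diff_congr (h : g =ᶠ[𝓝 p] g') : diff g p = diff g' p := h.mfderiv_eq

lemma diff_neg_normal (h : ν' =ᶠ[𝓝 p] -ν) : diff ν' p = -diff ν p :=
  (diff_congr h).trans mfderiv_neg

lemma MixedAreaZero.congr_normal (h : MixedAreaZero f ν' a b c d p) (hν : ν' =ᶠ[𝓝 p] ν) :
    MixedAreaZero f ν a b c d p := by
  have hcomb (r s : ℝ) : comb r s f ν' =ᶠ[𝓝 p] comb r s f ν :=
    hν.mono fun q hq => by simp only [comb, hq]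
  intro v w
  rw [← diff_congr (hcomb a b), ← diff_congr (hcomb c d), ← hν.eq_of_nhds]
  exact h v w

lemma MixedAreaZero.neg_normal (h : MixedAreaZero f ν' a b c d p) (hν : ν' =ᶠ[𝓝 p] -ν) :
    MixedAreaZero f ν a (-b) c (-d) p := by
  have hcomb (r s : ℝ) : comb r s f ν' =ᶠ[𝓝 p] comb r (-s) f ν :=
    hν.mono fun q hq => by simp only [comb, hq, Pi.neg_apply, smul_neg, neg_smul]
  intro v w
  have hvw := h v w
  rw [diff_congr (hcomb a b), diff_congr (hcomb c d), hν.eq_of_nhds, Pi.neg_apply,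
    mixedArea_neg_normal] at hvw
  exact neg_eq_zero.1 hvw

namespace LegendrianOn

lemma continuousAt (h : LegendrianOn f ν U) (hp : p ∈ U) : ContinuousAt f p :=
  h.smooth.continuousOn.continuousAt (h.isOpen.mem_nhds hp)

lemma continuousAt_normal (h : LegendrianOn f ν U) (hp : p ∈ U) : ContinuousAt ν p :=
  h.smooth_normal.continuousOn.continuousAt (h.isOpen.mem_nhds hp)

lemma normal_ne_zero (h : LegendrianOn f ν U) (hp : p ∈ U) : ν p ≠ 0 := fun h0 => by
  simpa [h0] using (h.normalFrame p hp).lor_self_normal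

variable {e : OpenPartialHomeomorph M ℂ}

lemma continuousAt_diff_comb_frame (h : LegendrianOn f ν U) (he : IsParam e) (heU : e.source ⊆ U)
    (hp : p ∈ e.source) (a b : ℝ) (c : ℂ) :
    ContinuousAt (fun q => diff (comb a b f ν) q (frame e (e q) c)) p := by
  have hpd := (contDiffOn_pd e.open_target
    (he.contDiffOn_comp_symm (h.smooth_comb a b) heU) c).continuousOn.continuousAt
    (e.open_target.mem_nhds (e.map_source hp))
  refine (hpd.comp (e.continuousAt hp)).congr ?_
  filter_upwards [e.open_source.mem_nhds hp] with q hq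
  rw [Function.comp_apply, h.pd_comb he heU (e.map_source hq), e.left_inv hq]

variable [IsManifold (𝓡 2) ∞ M]

lemma diff_comb_eq_zero_of_frequently (h : LegendrianOn f ν U) (hp : p ∈ U)
    (h0 : ∃ᶠ q in 𝓝 p, diff (comb a b f ν) q = 0) : diff (comb a b f ν) p = 0 := by
  obtain ⟨e, he, hpe, heU⟩ := exists_param p h.isOpen hp
  ext1 v
  have hsurj := he.frame_surjective (e.map_source hpe)
  obtain ⟨c, rfl⟩ := hsurj v
  exact isClosed_singleton.mem_of_frequently_of_tendsto
    (h0.mono fun q hq => by rw [hq]; rfl) (h.continuousAt_diff_comb_frame he heU hpe a b c)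

lemma mixedAreaZero_of_frequently (h : LegendrianOn f ν U) (hp : p ∈ U)
    (h0 : ∃ᶠ q in 𝓝 p, MixedAreaZero f ν a b c d q) : MixedAreaZero f ν a b c d p := by
  obtain ⟨e, he, hpe, heU⟩ := exists_param p h.isOpen hp
  intro v w
  have hsurj := he.frame_surjective (e.map_source hpe)
  obtain ⟨y, rfl⟩ := hsurj v
  obtain ⟨z, rfl⟩ := hsurj w
  have hf := h.continuousAt hp
  have hν := h.continuousAt_normal hp
  have hdiff (r s : ℝ) (z : ℂ) := h.continuousAt_diff_comb_frame he heU hpe r s z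
  have hmix : ContinuousAt (fun q => mixedArea (f q) (ν q) (diff (comb a b f ν) q)
      (diff (comb c d f ν) q) (frame e (e q) y) (frame e (e q) z)) p :=
    (continuousAt_area hf hν (hdiff a b y) (hdiff c d z)).add
      (continuousAt_area hf hν (hdiff c d y) (hdiff a b z))
  exact isClosed_singleton.mem_of_frequently_of_tendsto (h0.mono fun q hq => hq _ _) hmix

lemma eventually_isRegularPt_comb (h : LegendrianOn f ν U) (hp : p ∈ U)
    (hreg : IsRegularPt (comb a b f ν) p) : ∀ᶠ q in 𝓝 p, IsRegularPt (comb a b f ν) q := by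
  by_contra hcon
  rw [Filter.not_eventually] at hcon
  refine (h.not_isRegularPt_comb_iff hp a b).2 (h.mixedAreaZero_of_frequently hp ?_) hreg
  refine (hcon.and_eventually (h.isOpen.mem_nhds hp)).mono ?_
  exact fun q hq => (h.not_isRegularPt_comb_iff hq.2 a b).1 hq.1

lemma normal_eq_or_neg (h : LegendrianOn f ν U) (h' : LegendrianOn f ν' V) (hp : p ∈ U)
    (hp' : p ∈ V) (hreg : IsRegularPt f p) : ν' p = ν p ∨ ν' p = -ν p := by
  obtain ⟨-, hνν, hfν⟩ := h.normalFrame p hp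
  obtain ⟨-, hνν', hfν'⟩ := h'.normalFrame p hp'
  set u := ν' p - lor (ν' p) (ν p) • ν p with hu_def
  have hu : u ∈ tangentPlane (f p) (ν p) := by
    constructor <;> simp only [hu_def, sub_eq_add_neg, ← neg_smul, lor_add_left, lor_smul_left]
    · rw [lor_comm, hfν', lor_comm (ν p), hfν]; ring
    · rw [hνν]; ring
  have hdf := h.diff_mem_tangentPlane hp
  have horth (v : EuclideanSpace ℝ (Fin 2)) : lor (diff f p v) u = 0 := by
    simp only [hu_def, sub_eq_add_neg, ← neg_smul, lor_add_right, lor_smul_right,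
      h.lor_diff_normal p hp, h'.lor_diff_normal p hp']
    ring
  have harea := (h.normalFrame p hp).area_ne_zero hdf hreg
  have harea_u : area (f p) (ν p) (diff f p (tbasis 0)) u = 0 := by
    have := (h.normalFrame p hp).area_mul_area (hdf (tbasis 0)) hu (hdf (tbasis 0))
      (hdf (tbasis 1))
    rw [lor_comm u, lor_comm u, horth, horth, mul_zero, mul_zero, sub_zero] at this
    exact (mul_eq_zero.1 this).resolve_right harea
  have hne : diff f p (tbasis 0) ≠ 0 := fun h0 => harea (by rw [h0, area_zero_left])
  have hu0 : ν' p = lor (ν' p) (ν p) • ν p := sub_eq_zero.1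
    ((h.normalFrame p hp).eq_zero_of_area_of_lor (hdf _) hu hne harea_u (horth _))
  have hsq : lor (ν' p) (ν p) * lor (ν' p) (ν p) = 1 := by
    rw [hu0, lor_smul_left, lor_smul_right, hνν] at hνν'
    linarith
  rcases mul_self_eq_one_iff.1 hsq with h1 | h1
  · left; rw [hu0, h1, one_smul]
  · right; rw [hu0, h1, neg_one_smul]

lemma eventually_eq_or_neg (h : LegendrianOn f ν U) (h' : LegendrianOn f ν' V) (hp : p ∈ U)
    (hp' : p ∈ V) (hdense : ∀ᶠ q in 𝓝 p, q ∈ closure {x | IsRegularPt f x}) :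
    ν' =ᶠ[𝓝 p] ν ∨ ν' =ᶠ[𝓝 p] -ν := by
  have heither (q : M) (hq : q ∈ U) (hq' : q ∈ V) (hcl : q ∈ closure {x | IsRegularPt f x}) :
      ν' q = ν q ∨ ν' q = -ν q := by
    have hclosed : IsClosed {x : R41 × R41 | x.1 = x.2 ∨ x.1 = -x.2} :=
      (isClosed_eq continuous_fst continuous_snd).union
        (isClosed_eq continuous_fst continuous_snd.neg)
    have hfreq := (mem_closure_iff_frequently.1 hcl).and_eventually
      ((h.isOpen.inter h'.isOpen).mem_nhds ⟨hq, hq'⟩)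
    exact hclosed.mem_of_frequently_of_tendsto
      (hfreq.mono fun x hx => h.normal_eq_or_neg h' hx.2.1 hx.2.2 hx.1)
      ((h'.continuousAt_normal hq').prodMk_nhds (h.continuousAt_normal hq))
  have hnear : ∀ᶠ q in 𝓝 p, ν' q = ν q ∨ ν' q = -ν q := by
    filter_upwards [h.isOpen.mem_nhds hp, h'.isOpen.mem_nhds hp', hdense] using heither
  have hν := h.continuousAt_normal hp
  have hν' := h'.continuousAt_normal hp'
  have hne : ν p ≠ -ν p := fun heq => h.normal_ne_zero hp (self_eq_neg.1 heq)
  rcases hnear.self_of_nhds with heq | heq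
  · left
    filter_upwards [hnear, (hν'.add hν).eventually_ne (y := 0) fun h0 =>
      hne (heq.symm.trans (eq_neg_of_add_eq_zero_left h0))] with q hq hqne
    exact hq.resolve_right fun h0 => hqne (by simp [h0])
  · right
    filter_upwards [hnear, (hν'.sub hν).eventually_ne (y := 0) fun h0 =>
      hne ((sub_eq_zero.1 h0).symm.trans heq)] with q hq hqne
    exact hq.resolve_left fun h0 => hqne (by simp [h0])

end LegendrianOn

lemma eventually_eq_of_diff_eq_zero [IsManifold (𝓡 2) ∞ M] (hU : IsOpen U) (hp : p ∈ U)
    (hg : ContMDiffOn (𝓡 2) 𝓘(ℝ, R41) ∞ g U) (h0 : ∀ᶠ q in 𝓝 p, diff g q = 0) :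
    ∀ᶠ q in 𝓝 p, g q = g p := by
  obtain ⟨T, hT, hTo, hpT⟩ := mem_nhds_iff.1 h0
  obtain ⟨e, he, hpe, heUT⟩ := exists_param p (hU.inter hTo) ⟨hp, hpT⟩
  have heU : e.source ⊆ U := heUT.trans Set.inter_subset_left
  obtain ⟨r, hr, hball⟩ := Metric.isOpen_iff.1 e.open_target (e p) (e.map_source hpe)
  have hderiv : Set.EqOn (fderiv ℝ (g ∘ e.symm)) 0 (Metric.ball (e p) r) := by
    intro w hw
    ext1 c
    have hq := e.map_target (hball hw)
    have hpd := he.pd_comp_symm (hball hw) (mdifferentiableAt_of_contMDiffOn hU hg (heU hq)) c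
    exact hpd.trans (DFunLike.congr_fun (hT (heUT hq).2) _)
  have hconst (w : ℂ) (hw : w ∈ Metric.ball (e p) r) : g (e.symm w) = g (e.symm (e p)) :=
    Metric.isOpen_ball.is_const_of_fderiv_eq_zero (convex_ball _ _).isPreconnected
      (((he.contDiffOn_comp_symm hg heU).differentiableOn (by simp)).mono hball) hderiv hw
      (Metric.mem_ball_self hr)
  filter_upwards [e.open_source.mem_nhds hpe,
    (e.continuousAt hpe).eventually (Metric.ball_mem_nhds _ hr)] with q hq hqr
  rw [← e.left_inv hq, hconst _ hqr, e.left_inv hpe]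

lemma eq_of_diff_eq_zero [IsManifold (𝓡 2) ∞ M] [ConnectedSpace M]
    (hg : ContMDiff (𝓡 2) 𝓘(ℝ, R41) ∞ g) (h0 : ∀ q, diff g q = 0) (p q : M) : g p = g q := by
  have hloc : IsLocallyConstant g := (IsLocallyConstant.iff_eventually_eq g).2 fun x =>
    eventually_eq_of_diff_eq_zero isOpen_univ (Set.mem_univ x) hg.contMDiffOn (.of_forall h0)
  exact hloc.apply_eq_of_preconnectedSpace p q

end limits

/-! ### Density of the regular points -/

section density

variable {M : Type*} [TopologicalSpace M] [ChartedSpace (EuclideanSpace ℝ (Fin 2)) M]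
  {f ν : M → R41} {U : Set M} {p : M} {a b c d ε : ℝ}

lemma IsRegularPt.diff_ne_zero (h : IsRegularPt f p) : diff f p ≠ 0 := fun h0 =>
  one_ne_zero (α := ℝ) <| by
    simpa [tbasis] using congrArg (fun v => v 0) (h (a₁ := tbasis 0) (a₂ := 0) (by simp [h0]))

lemma LegendrianOn.mixedAreaZero_iff (h : LegendrianOn f ν U) (hp : p ∈ U) :
    MixedAreaZero f ν a b c d p ↔ ∀ v w,
      a * c * mixedArea (f p) (ν p) (diff f p) (diff f p) v w +
        (a * d + b * c) * mixedArea (f p) (ν p) (diff f p) (diff ν p) v w +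
        b * d * mixedArea (f p) (ν p) (diff ν p) (diff ν p) v w = 0 := by
  simp only [MixedAreaZero, h.mixedArea_comb hp]

lemma IsFrontH3.legendrianOn (hf : IsFrontH3 f) (hU : IsOpen U) (h : IsUnitNormalOn S31 f ν U) :
    LegendrianOn f ν U where
  isOpen := hU
  smooth := hf.1.contMDiffOn
  smooth_normal := h.1
  normalFrame p hp := ⟨(hf.2.1 p).1, (h.2 p hp).1, (h.2 p hp).2.1⟩
  lor_diff_normal p hp := (h.2 p hp).2.2

variable [IsManifold (𝓡 2) ∞ M]

namespace LegendrianOn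

lemma diff_comb_eq_zero_of_not_isRegularPt (h : LegendrianOn f ν U)
    (hpair : PairImmersionOn f ν U) (hab : a ≠ b) (hp : p ∈ U)
    (hmix : MixedAreaZero f ν 1 1 a b p) (hsing : ¬ IsRegularPt (comb a b f ν) p) :
    diff (comb a b f ν) p = 0 := by
  refine h.diff_comb_eq_zero_of_singular hp (hpair p hp) (c := 1) (d := 1)
    (by simpa [sub_eq_zero] using hab) (fun v w => ?_) hsing
  rw [mixedArea_comm]
  exact hmix v w

/-- Where `d(a f + b ν)` is not injective it vanishes, and its zeros can only accumulate where it
vanishes identically. -/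
lemma eventually_diff_comb_eq_zero (h : LegendrianOn f ν U) (hpair : PairImmersionOn f ν U)
    (hab : a ≠ b) (hmix : ∀ q ∈ U, MixedAreaZero f ν 1 1 a b q) (hp : p ∈ U)
    (hsing : ∃ᶠ q in 𝓝[≠] p, ¬ IsRegularPt (comb a b f ν) q) :
    ∀ᶠ q in 𝓝 p, diff (comb a b f ν) q = 0 := by
  have hdet : (1 : ℝ) * b - 1 * a ≠ 0 := by simpa [sub_eq_zero] using hab.symm
  have hzero : ∃ᶠ q in 𝓝[≠] p, diff (comb a b f ν) q = 0 :=
    (hsing.and_eventually (nhdsWithin_le_nhds (h.isOpen.mem_nhds hp))).mono fun q ⟨hq, hqU⟩ =>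
      h.diff_comb_eq_zero_of_not_isRegularPt hpair hab hqU (hmix q hqU) hq
  have hzero_p := h.diff_comb_eq_zero_of_frequently hp
    (hzero.filter_mono nhdsWithin_le_nhds)
  have hreg : IsRegularPt (comb 1 1 f ν) p := (injective_iff_map_eq_zero _).2 fun v hv =>
    h.eq_zero_of_diff_comb hp (hpair p hp) hdet hv (by rw [hzero_p]; rfl)
  exact (h.diff_comb_eq_zero_or_isolated hp hmix hreg).resolve_right fun hiso =>
    hzero (hiso.mono fun q hq => hq)

lemma right_ne_zero (h : LegendrianOn f ν U) (hpair : PairImmersionOn f ν U)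
    (hmix : ∀ q ∈ U, MixedAreaZero f ν 1 1 a b q) (hab : a ≠ 0 ∨ b ≠ 0) (hp : p ∈ U)
    (hreg : ∃ᶠ q in 𝓝 p, IsRegularPt f q) (hsing : ∃ᶠ q in 𝓝[≠] p, ¬ IsRegularPt f q) :
    b ≠ 0 := fun hb => by
  have ha : a ≠ 0 := hab.resolve_right (not_not.2 hb)
  have hmix' (q : M) (hq : q ∈ U) : MixedAreaZero f ν 1 1 1 0 q := by
    refine h.mixedAreaZero_of_proportional hq (hmix q hq) a⁻¹ ?_ ?_ ?_ <;> simp [hb, ha]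
  have hzero := h.eventually_diff_comb_eq_zero hpair one_ne_zero hmix' hp
  rw [comb_one_zero] at hzero
  obtain ⟨q, hq, hq0⟩ := (hreg.and_eventually (hzero hsing)).exists
  exact hq.diff_ne_zero hq0

/-- If `f` is singular everywhere then so is `(a + b) f + 2b ν`, by the relation, and two different
combinations are both singular only if they are orthogonal. -/
lemma add_eq_zero_of_singular (h : LegendrianOn f ν U) (hpair : PairImmersionOn f ν U)
    (hmix : ∀ q ∈ U, MixedAreaZero f ν 1 1 a b q) (hb : b ≠ 0) (hp : p ∈ U)
    (hsing : ∀ q ∈ U, ¬ IsRegularPt f q) : a + b = 0 := by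
  have hsing_comb (q : M) (hq : q ∈ U) : ¬ IsRegularPt (comb (a + b) (2 * b) f ν) q := by
    have hf := hsing q hq
    rw [← comb_one_zero f ν] at hf
    rw [h.not_isRegularPt_comb_iff hq, h.mixedAreaZero_iff hq] at *
    intro v w
    linear_combination 4 * b * (h.mixedAreaZero_iff hq).1 (hmix q hq) v w +
      ((a + b) ^ 2 - 4 * a * b) * hf v w
  have := h.lor_comb_eq_zero_of_singular hp (hpair p hp) (a := 1) (b := 0)
    (by simpa using hb) (by rwa [comb_one_zero]) hsing_comb
  linarith

/-- The relation is that of flat fronts, for which `f` and `ν` become singular together when one of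
the Gauss maps `f ± ν` is singular. -/
lemma isRegularPt_of_flat (h : LegendrianOn f ν U) (hpair : PairImmersionOn f ν U) (hp : p ∈ U)
    (hflat : MixedAreaZero f ν 1 1 (-1) 1 p)
    (hgauss : ∃ᶠ q in 𝓝 p, MixedAreaZero f ν 1 1 1 1 q ∨ MixedAreaZero f ν 1 (-1) 1 (-1) q) :
    IsRegularPt f p := by
  by_contra hsing
  have hff : MixedAreaZero f ν 1 0 1 0 p := by
    rwa [← h.not_isRegularPt_comb_iff hp, comb_one_zero]
  have hff' := (h.mixedAreaZero_iff hp).1 hff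
  have hflat' := (h.mixedAreaZero_iff hp).1 hflat
  have hfν : MixedAreaZero f ν 1 0 0 1 p := by
    rw [h.mixedAreaZero_iff hp]
    intro v w
    rcases Filter.frequently_or_distrib.1 hgauss with h0 | h0
    · have hplus := (h.mixedAreaZero_iff hp).1 (h.mixedAreaZero_of_frequently hp h0)
      linear_combination (1 / 2) * hplus v w - (1 / 2) * hflat' v w - hff' v w
    · have hminus := (h.mixedAreaZero_iff hp).1 (h.mixedAreaZero_of_frequently hp h0)
      linear_combination -(1 / 2) * hminus v w + (1 / 2) * hflat' v w + hff' v w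
  have hνν : ¬ IsRegularPt ν p := by
    rw [← comb_zero_one f ν, h.not_isRegularPt_comb_iff hp, h.mixedAreaZero_iff hp]
    intro v w
    linear_combination hflat' v w + hff' v w
  rw [← comb_one_zero f ν] at hsing
  have hdf := h.diff_comb_eq_zero_of_singular hp (hpair p hp) (by norm_num) hfν hsing
  rw [comb_one_zero] at hdf
  exact hνν ((injective_iff_map_eq_zero _).2 fun v => hpair p hp v (by rw [hdf]; rfl))

end LegendrianOn

lemma IsHLWFront.exists_relation (hf : IsHLWFront f) (p : M) :
    ∃ (U : Set M) (ν : M → R41) (a b : ℝ), p ∈ U ∧ LegendrianOn f ν U ∧ PairImmersionOn f ν U ∧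
      (a ≠ 0 ∨ b ≠ 0) ∧ ∀ q ∈ U, MixedAreaZero f ν 1 1 a b q := by
  obtain ⟨U, hU, hp, ν, hν, δ, hreg, α, β, hαβ, hlw⟩ := hf.2.2 p
  have h := hf.1.legendrianOn hU hν
  refine ⟨U, ν, _, _, hp, h, fun q hq v hf hν => ?_, ?_, fun q hq =>
    h.mixedAreaZero_of_par hq (hreg q hq) (hlw q hq)⟩
  · refine (injective_iff_map_eq_zero _).1 (hreg q hq) v ?_
    rw [par_eq_comb, h.diff_comb hq, add_apply, smul_apply, smul_apply, hf, hν, smul_zero,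
      smul_zero, add_zero]
  · by_contra! h0
    have hcs := Real.cosh_sq_sub_sinh_sq δ
    have hβ : β = 0 := by
      linear_combination Real.cosh δ * h0.2 - Real.sinh δ * h0.1 - β * hcs
    have hadd : α + β = 0 := by
      linear_combination Real.sinh δ * h0.2 - Real.cosh δ * h0.1 - (α + β) * hcs
    simp [hβ, show α = 0 by linarith] at hαβ

lemma isOpen_isRegularPt (hf : IsHLWFront f) : IsOpen {q | IsRegularPt f q} := by
  refine isOpen_iff_mem_nhds.2 fun p hp => ?_
  obtain ⟨U, ν, -, -, hpU, h, -⟩ := hf.exists_relation p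
  have := h.eventually_isRegularPt_comb (a := 1) (b := 0) hpU
  rw [comb_one_zero] at this
  exact this hp

lemma exists_normal_of_mem_W (hf : f ∈ W M ε) (p : M) : ∃ (U : Set M) (ν : M → R41), p ∈ U ∧
    LegendrianOn f ν U ∧
      ∀ q ∈ U, IsRegularPt f q → MixedAreaZero f ν 1 1 (-(1 + ε)) (1 - ε) q := by
  obtain ⟨U, hU, hpU, ν, hν, hlw⟩ := hf.2 p
  have h := hf.1.1.legendrianOn hU hν
  exact ⟨U, ν, hpU, h, fun q hq hreg => (h.weingarten_iff hq hreg ε).1 (hlw q hq hreg)⟩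

lemma gauss_singular_of_flat (hε : ε ≠ 0) (hf : f ∈ W M ε) (h : LegendrianOn f ν U) (hp : p ∈ U)
    (hflat : MixedAreaZero f ν 1 1 (-1) 1 p) (hreg : IsRegularPt f p) :
    MixedAreaZero f ν 1 1 1 1 p ∨ MixedAreaZero f ν 1 (-1) 1 (-1) p := by
  obtain ⟨V, ν', hpV, h', hW⟩ := exists_normal_of_mem_W hf p
  have hflat' := (h.mixedAreaZero_iff hp).1 hflat
  have hcl : ∀ᶠ q in 𝓝 p, q ∈ closure {x | IsRegularPt f x} :=
    Filter.mem_of_superset ((isOpen_isRegularPt hf.1).mem_nhds hreg) subset_closure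
  rcases h.eventually_eq_or_neg h' hp hpV hcl with hν | hν
  · left
    have hW' := (h.mixedAreaZero_iff hp).1 ((hW p hpV hreg).congr_normal hν)
    refine (h.mixedAreaZero_iff hp).2 fun v w => mul_left_cancel₀ hε ?_
    linear_combination -hW' v w + hflat' v w
  · right
    have hW' := (h.mixedAreaZero_iff hp).1 ((hW p hpV hreg).neg_normal hν)
    refine (h.mixedAreaZero_iff hp).2 fun v w => mul_left_cancel₀ hε ?_
    linear_combination -hW' v w + hflat' v w

lemma closure_mem_nhds_of_mem_W (hε : ε ≠ 0) (hf : f ∈ W M ε)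
    (hreg : p ∈ closure {q | IsRegularPt f q}) : closure {q | IsRegularPt f q} ∈ 𝓝 p := by
  by_contra hcon
  have hfreq := mem_closure_iff_frequently.1 hreg
  have hsing : ∃ᶠ q in 𝓝 p, q ∈ (closure {q | IsRegularPt f q})ᶜ := Filter.not_eventually.1 hcon
  have not_regular (q : M) (hq : q ∈ (closure {q | IsRegularPt f q})ᶜ) : ¬ IsRegularPt f q :=
    fun hq' => hq (subset_closure hq')
  obtain ⟨U, ν, a, b, hp, h, hpair, hab, hmix⟩ := hf.1.exists_relation p
  have hsing' : ∃ᶠ q in 𝓝[≠] p, ¬ IsRegularPt f q := frequently_nhdsWithin_iff.2 <|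
    hsing.mono fun q hq => ⟨not_regular q hq, fun hqp => hq (hqp ▸ hreg)⟩
  have hb : b ≠ 0 := h.right_ne_zero hpair hmix hab hp hfreq hsing'
  have hadd : a + b = 0 := by
    obtain ⟨q, hq, hqU⟩ := (hsing.and_eventually (h.isOpen.mem_nhds hp)).exists
    have hV := h.isOpen.inter (isClosed_closure (s := {q | IsRegularPt f q})).isOpen_compl
    exact (h.mono hV Set.inter_subset_left).add_eq_zero_of_singular
      (fun x hx => hpair x hx.1) (fun x hx => hmix x hx.1) hb ⟨hqU, hq⟩
      fun x hx => not_regular x hx.2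
  have hflat (q : M) (hq : q ∈ U) : MixedAreaZero f ν 1 1 (-1) 1 q := by
    refine h.mixedAreaZero_of_proportional hq (hmix q hq) b⁻¹ ?_ ?_ ?_ <;>
      simp [hb, eq_neg_of_add_eq_zero_left hadd]
  have hreg_p : IsRegularPt f p := h.isRegularPt_of_flat hpair hp (hflat p hp) <|
    (hfreq.and_eventually (h.isOpen.mem_nhds hp)).mono fun q ⟨hq, hqU⟩ =>
      gauss_singular_of_flat hε hf h hqU (hflat q hqU) hq
  exact hcon (Filter.mem_of_superset ((isOpen_isRegularPt hf.1).mem_nhds hreg_p) subset_closure)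

theorem dense_isRegularPt [ConnectedSpace M] (hε : ε ≠ 0) (hf : f ∈ W M ε) :
    Dense {q | IsRegularPt f q} := by
  have hopen : IsOpen (closure {q | IsRegularPt f q}) :=
    isOpen_iff_mem_nhds.2 fun p hp => closure_mem_nhds_of_mem_W hε hf hp
  exact dense_iff_closure_eq.2 <|
    IsClopen.eq_univ ⟨isClosed_closure, hopen⟩ (hf.1.2.1.imp fun p hp => subset_closure hp)

end density

/-! ### The global normal -/

section global

variable {M : Type*} [TopologicalSpace M] [ChartedSpace (EuclideanSpace ℝ (Fin 2)) M]
  {f ν ν' : M → R41} {U V : Set M} {p : M} {ε : ℝ}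

/-- A normal on an open set `U` with respect to which `f` is a front there and satisfies
`2ε(H - 1) + (1 - ε)K = 0`, the relation being extended to the singular points. -/
structure IsWeingartenNormal (ε : ℝ) (f ν : M → R41) (U : Set M) : Prop
    extends LegendrianOn f ν U where
  pairImmersion : PairImmersionOn f ν U
  mixedAreaZero : ∀ p ∈ U, MixedAreaZero f ν 1 1 (-(1 + ε)) (1 - ε) p

lemma IsWeingartenNormal.mono (h : IsWeingartenNormal ε f ν U) (hV : IsOpen V) (hVU : V ⊆ U) :
    IsWeingartenNormal ε f ν V where
  toLegendrianOn := h.toLegendrianOn.mono hV hVU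
  pairImmersion p hp := h.pairImmersion p (hVU hp)
  mixedAreaZero p hp := h.mixedAreaZero p (hVU hp)

lemma IsWeingartenNormal.mixedAreaZero_of_neg (hε : ε ≠ 0) (h : IsWeingartenNormal ε f ν U)
    (h' : IsWeingartenNormal ε f ν' V) (hp : p ∈ U) (hp' : p ∈ V) (hν : ν' =ᶠ[𝓝 p] -ν) :
    MixedAreaZero f ν 1 0 0 1 p := by
  have hrel := (h.mixedAreaZero_iff hp).1 (h.mixedAreaZero p hp)
  have hrel' := (h.mixedAreaZero_iff hp).1 ((h'.mixedAreaZero p hp').neg_normal hν)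
  refine (h.mixedAreaZero_iff hp).2 fun v w => mul_left_cancel₀ hε ?_
  linear_combination (hrel' v w - hrel v w) / 4

lemma LegendrianOn.isUnitNormalOn (h : LegendrianOn f ν U) : IsUnitNormalOn S31 f ν U :=
  ⟨h.smooth_normal, fun p hp =>
    ⟨(h.normalFrame p hp).lor_self_normal, (h.normalFrame p hp).lor_normal,
      h.lor_diff_normal p hp⟩⟩

lemma PairImmersionOn.of_eq_or_neg (h : PairImmersionOn f ν U) (hp : p ∈ U)
    (hν : ν' =ᶠ[𝓝 p] ν ∨ ν' =ᶠ[𝓝 p] -ν) (v : EuclideanSpace ℝ (Fin 2)) (hf : diff f p v = 0)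
    (hν' : diff ν' p v = 0) : v = 0 := by
  refine h p hp v hf ?_
  rcases hν with hν | hν
  · rwa [← diff_congr hν]
  · rwa [diff_neg_normal hν, neg_apply, neg_eq_zero] at hν'

variable [IsManifold (𝓡 2) ∞ M]

lemma legendrianOn_const {v : R41} (hU : IsOpen U) (hf : ContMDiffOn (𝓡 2) 𝓘(ℝ, R41) ∞ f U)
    (hff : ∀ q ∈ U, lor (f q) (f q) = -1) (hvv : lor v v = 1) (hfv : ∀ q ∈ U, lor (f q) v = 0) :
    LegendrianOn f (fun _ => v) U where
  isOpen := hU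
  smooth := hf
  smooth_normal := contMDiffOn_const
  normalFrame q hq := ⟨hff q hq, hvv, hfv q hq⟩
  lor_diff_normal q hq w := by
    have := lor_diff_add_lor_diff hU hf contMDiffOn_const hfv hq w
    rwa [show diff (fun _ => v) q w = 0 from DFunLike.congr_fun mfderiv_const w, lor_zero_right,
      add_zero] at this

lemma LegendrianOn.isWeingartenNormal (h : LegendrianOn f ν U) (hf : IsHLWFront f)
    (hd : Dense {q | IsRegularPt f q})
    (hrel : ∀ q ∈ U, IsRegularPt f q → MixedAreaZero f ν 1 1 (-(1 + ε)) (1 - ε) q) :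
    IsWeingartenNormal ε f ν U where
  toLegendrianOn := h
  pairImmersion p hp := by
    obtain ⟨V, ν', -, -, hpV, h', hpair, -⟩ := hf.exists_relation p
    exact hpair.of_eq_or_neg hpV (h'.eventually_eq_or_neg h hpV hp (.of_forall hd))
  mixedAreaZero p hp := h.mixedAreaZero_of_frequently hp <|
    ((mem_closure_iff_frequently.1 (hd p)).and_eventually (h.isOpen.mem_nhds hp)).mono
      fun q ⟨hreg, hq⟩ => hrel q hq hreg

lemma exists_isWeingartenNormal (hf : f ∈ W M ε) (hd : Dense {q | IsRegularPt f q}) (p : M) :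
    ∃ (U : Set M) (ν : M → R41), p ∈ U ∧ IsWeingartenNormal ε f ν U := by
  obtain ⟨U, ν, hp, h, hrel⟩ := exists_normal_of_mem_W hf p
  exact ⟨U, ν, hp, h.isWeingartenNormal hf.1 hd hrel⟩

lemma LegendrianOn.eventually_eq_const_or_neg {v : R41} (h : LegendrianOn f ν U)
    (hd : Dense {q | IsRegularPt f q}) (hp : p ∈ U) (hvv : lor v v = 1)
    (hfv : ∀ᶠ q in 𝓝 p, lor (f q) v = 0) : (∀ᶠ q in 𝓝 p, ν q = v) ∨ ∀ᶠ q in 𝓝 p, ν q = -v := by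
  obtain ⟨T, hT, hTo, hpT⟩ := mem_nhds_iff.1 hfv
  have hv : LegendrianOn f (fun _ => v) (T ∩ U) := legendrianOn_const (hTo.inter h.isOpen)
    (h.smooth.mono Set.inter_subset_right) (fun q hq => (h.normalFrame q hq.2).lor_self) hvv
    fun q hq => hT hq.1
  exact hv.eventually_eq_or_neg h ⟨hpT, hp⟩ hp (.of_forall hd)

namespace IsWeingartenNormal

lemma eventually_lor_eq_zero_of_frequently {v : R41} (h : IsWeingartenNormal (-1) f ν U)
    (hd : Dense {q | IsRegularPt f q}) (hp : p ∈ U) (hvv : lor v v = 1)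
    (hfv : ∃ᶠ q in 𝓝 p, ∀ᶠ x in 𝓝 q, lor (f x) v = 0) : ∀ᶠ q in 𝓝 p, lor (f q) v = 0 := by
  by_contra hcon
  have hU := h.isOpen.mem_nhds hp
  have hconst (q : M) (hq : q ∈ U) (hqv : ∀ᶠ x in 𝓝 q, lor (f x) v = 0) :=
    h.eventually_eq_const_or_neg hd hq hvv hqv
  have hsing (q : M) (hq : q ∈ U) (hqv : ∀ᶠ x in 𝓝 q, lor (f x) v = 0) : ¬ IsRegularPt ν q := by
    refine fun hreg => hreg.diff_ne_zero ?_
    rcases hconst q hq hqv with hν | hν <;> exact (diff_congr hν).trans mfderiv_const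
  have hmix (q : M) (hq : q ∈ U) : MixedAreaZero f ν 1 1 0 1 q :=
    h.mixedAreaZero_of_proportional hq (h.mixedAreaZero q hq) (1 / 2) (by norm_num) (by norm_num)
      (by norm_num)
  have hzero : ∀ᶠ q in 𝓝 p, diff ν q = 0 := by
    have := h.eventually_diff_comb_eq_zero h.pairImmersion zero_ne_one hmix hp
    rw [comb_zero_one] at this
    exact this <| frequently_nhdsWithin_iff.2 <| (hfv.and_eventually hU).mono
      fun q ⟨hqv, hq⟩ => ⟨hsing q hq hqv, fun hqp => hcon (hqp ▸ hqv)⟩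
  have hνp := eventually_eq_of_diff_eq_zero h.isOpen hp h.smooth_normal hzero
  obtain ⟨x, ⟨hxv, hx⟩, hxp⟩ := ((hfv.and_eventually hU).and_eventually hνp).exists
  refine hcon ?_
  filter_upwards [hνp, hU] with q hqp hq
  have hfν := (h.normalFrame q hq).lor_normal
  rcases hconst x hx hxv with hν | hν <;> rw [hqp, ← hxp, hν.self_of_nhds] at hfν
  · exact hfν
  · rwa [lor_neg_right, neg_eq_zero] at hfν

lemma inEquidistant_of_diff_normal_eq_zero [ConnectedSpace M] (hf : f ∈ W M (-1))
    (hd : Dense {q | IsRegularPt f q}) (h : IsWeingartenNormal (-1) f ν U) (hp : p ∈ U)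
    (h0 : ∀ᶠ q in 𝓝 p, diff ν q = 0) : InEquidistant f := by
  have hvv := (h.normalFrame p hp).lor_self_normal
  have hpS : ∀ᶠ q in 𝓝 p, lor (f q) (ν p) = 0 := by
    filter_upwards [h.isOpen.mem_nhds hp,
      eventually_eq_of_diff_eq_zero h.isOpen hp h.smooth_normal h0] with q hq hqp
    rw [← hqp]
    exact (h.normalFrame q hq).lor_normal
  have hopen : IsOpen {q | ∀ᶠ x in 𝓝 q, lor (f x) (ν p) = 0} :=
    isOpen_iff_mem_nhds.2 fun q hq => eventually_eventually_nhds.2 hq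
  have hclosed : IsClosed {q | ∀ᶠ x in 𝓝 q, lor (f x) (ν p) = 0} := by
    refine isClosed_iff_frequently.2 fun q hq => ?_
    obtain ⟨V, ν', hqV, h'⟩ := exists_isWeingartenNormal hf hd q
    exact h'.eventually_lor_eq_zero_of_frequently hd hqV hvv hq
  have huniv := IsClopen.eq_univ ⟨hclosed, hopen⟩ ⟨p, hpS⟩
  exact ⟨ν p, hvv ▸ one_pos, 0, fun q =>
    (huniv.symm.subset (Set.mem_univ q)).self_of_nhds⟩

/-- If `fν = 0` and `ε < -1` then `√(-1-ε) f ± √(1-ε) ν` are both singular everywhere, without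
being orthogonal. -/
lemma neg_one_le_of_mixedAreaZero (h : IsWeingartenNormal ε f ν U) (hp : p ∈ U)
    (hmix : ∀ q ∈ U, MixedAreaZero f ν 1 0 0 1 q) : -1 ≤ ε := by
  by_contra! hlt
  set a := √(-(1 + ε))
  set b := √(1 - ε)
  have ha : 0 < a := Real.sqrt_pos.2 (by linarith)
  have hb : 0 < b := Real.sqrt_pos.2 (by linarith)
  have ha2 : a ^ 2 = -(1 + ε) := Real.sq_sqrt (by linarith)
  have hb2 : b ^ 2 = 1 - ε := Real.sq_sqrt (by linarith)
  have hsing (c : ℝ) (hc : c ^ 2 = b ^ 2) (q : M) (hq : q ∈ U) :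
      ¬ IsRegularPt (comb a c f ν) q := by
    rw [h.not_isRegularPt_comb_iff hq, h.mixedAreaZero_iff hq]
    intro v w
    have hrel := (h.mixedAreaZero_iff hq).1 (h.mixedAreaZero q hq) v w
    have hfν := (h.mixedAreaZero_iff hq).1 (hmix q hq) v w
    rw [← sq, ← sq, hc, ha2, hb2]
    linear_combination hrel + (2 * ε + 2 * a * c) * hfν
  have horth : b * -b = a * a :=
    h.lor_comb_eq_zero_of_singular hp (h.pairImmersion p hp) (by nlinarith [mul_pos ha hb])
      (hsing b rfl) (hsing (-b) (neg_sq b))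
  nlinarith [mul_pos ha ha, mul_pos hb hb]

lemma le_neg_one_of_mixedAreaZero (hε : ε < 0) (h : IsWeingartenNormal ε f ν U) (hp : p ∈ U)
    (hmix : MixedAreaZero f ν 1 0 0 1 p) (hreg : IsRegularPt f p) : ε ≤ -1 := by
  by_contra! hlt
  have hF := h.normalFrame p hp
  have hne := hF.area_ne_zero (h.diff_mem_tangentPlane hp) hreg
  have hrel := (h.mixedAreaZero_iff hp).1 (h.mixedAreaZero p hp) (tbasis 0) (tbasis 1)
  have hfν (v w : EuclideanSpace ℝ (Fin 2)) :
      mixedArea (f p) (ν p) (diff f p) (diff ν p) v w = 0 := by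
    simpa only [MixedAreaZero, comb_one_zero, comb_zero_one] using hmix v w
  have hle := hF.area_mul_area_nonpos (h.diff_mem_tangentPlane hp)
    (h.diff_normal_mem_tangentPlane hp) (h.lor_diff_comm hp) hfν (tbasis 0) (tbasis 1)
  rw [hfν, mixedArea_self, mixedArea_self] at hrel
  set A := area (f p) (ν p) (diff f p (tbasis 0)) (diff f p (tbasis 1))
  set B := area (f p) (ν p) (diff ν p (tbasis 0)) (diff ν p (tbasis 1))
  have hAB : (1 - ε) * (A * B) = (1 + ε) * A ^ 2 := by linear_combination A / 2 * hrel
  have hpos : 0 < (1 + ε) * A ^ 2 := by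
    have : 0 < A ^ 2 := by positivity
    exact mul_pos (by linarith) this
  exact absurd hAB (by nlinarith)

lemma diff_normal_eq_zero (h : IsWeingartenNormal (-1) f ν U) (hp : p ∈ U)
    (hmix : MixedAreaZero f ν 1 0 0 1 p) : diff ν p = 0 := by
  have hνν : MixedAreaZero f ν 1 1 0 1 p :=
    h.mixedAreaZero_of_proportional hp (h.mixedAreaZero p hp) (1 / 2) (by norm_num) (by norm_num)
      (by norm_num)
  have hsing : ¬ IsRegularPt (comb 0 1 f ν) p := by
    rw [h.not_isRegularPt_comb_iff hp, h.mixedAreaZero_iff hp]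
    intro v w
    linear_combination (h.mixedAreaZero_iff hp).1 hνν v w - (h.mixedAreaZero_iff hp).1 hmix v w
  rw [← comb_zero_one f ν]
  exact h.diff_comb_eq_zero_of_not_isRegularPt h.pairImmersion zero_ne_one hp hνν hsing

lemma not_eventuallyEq_neg [ConnectedSpace M] (hε : ε < 0) (hf : f ∈ W M ε)
    (hne : ¬ InEquidistant f) (h : IsWeingartenNormal ε f ν U) (h' : IsWeingartenNormal ε f ν' V)
    (hp : p ∈ U) (hp' : p ∈ V) : ¬ ν' =ᶠ[𝓝 p] -ν := fun hν => by
  have hd := dense_isRegularPt hε.ne hf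
  obtain ⟨T, hT, hTo, hpT⟩ := mem_nhds_iff.1 (eventually_eventually_nhds.2 hν)
  have hO : IsOpen (T ∩ (U ∩ V)) := hTo.inter (h.isOpen.inter h'.isOpen)
  have hpO : p ∈ T ∩ (U ∩ V) := ⟨hpT, hp, hp'⟩
  have hO_normal := h.mono hO fun q hq => hq.2.1
  have hmix (q : M) (hq : q ∈ T ∩ (U ∩ V)) : MixedAreaZero f ν 1 0 0 1 q :=
    h.mixedAreaZero_of_neg hε.ne h' hq.2.1 hq.2.2 (hT hq.1)
  obtain ⟨q, hq, hqreg⟩ := hd.inter_open_nonempty _ hO ⟨p, hpO⟩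
  obtain rfl : ε = -1 :=
    le_antisymm (hO_normal.le_neg_one_of_mixedAreaZero hε hq (hmix q hq) hqreg)
      (hO_normal.neg_one_le_of_mixedAreaZero hpO hmix)
  refine hne (inEquidistant_of_diff_normal_eq_zero hf hd h hp ?_)
  filter_upwards [hO.mem_nhds hpO] with q hq using hO_normal.diff_normal_eq_zero hq (hmix q hq)

end IsWeingartenNormal

theorem exists_global_isWeingartenNormal [ConnectedSpace M] (hε : ε < 0) (hf : f ∈ W M ε)
    (hne : ¬ InEquidistant f) : ∃ ν : M → R41, IsWeingartenNormal ε f ν Set.univ := by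
  have hd := dense_isRegularPt hε.ne hf
  choose U n hpU h using exists_isWeingartenNormal hf hd
  have hagree (p q : M) (hq : q ∈ U p) : n q q = n p q :=
    ((h p).eventually_eq_or_neg (h q).toLegendrianOn hq (hpU q) (.of_forall hd)).resolve_right
      ((h p).not_eventuallyEq_neg hε hf hne (h q) hq (hpU q)) |>.eq_of_nhds
  have hnear (p : M) : (fun q => n q q) =ᶠ[𝓝 p] n p := by
    filter_upwards [(h p).isOpen.mem_nhds (hpU p)] with q hq using hagree p q hq
  have hnormal : LegendrianOn f (fun q => n q q) Set.univ :=
    { isOpen := isOpen_univ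
      smooth := hf.1.1.1.contMDiffOn
      smooth_normal := fun p _ => (((h p).smooth_normal.contMDiffAt
        ((h p).isOpen.mem_nhds (hpU p))).congr_of_eventuallyEq (hnear p)).contMDiffWithinAt
      normalFrame := fun p _ => (h p).normalFrame p (hpU p)
      lor_diff_normal := fun p _ => (h p).lor_diff_normal p (hpU p) }
  exact ⟨_, hnormal.isWeingartenNormal hf.1 hd fun p _ _ =>
    ((h p).mixedAreaZero p (hpU p)).congr_normal (hnear p).symm⟩

end global

/-! ### CMC-1 fronts in de Sitter space -/

section cmc

lemma smul_add_smul_mem_H3 {x y : R41} (hx : x ∈ H3) (h : NormalFrame x y) (δ : ℝ) :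
    Real.cosh δ • x + Real.sinh δ • y ∈ H3 := by
  have hcs := Real.cosh_sq_sub_sinh_sq δ
  constructor
  · simp only [lor_add_left, lor_add_right, lor_smul_left, lor_smul_right, lor_comm y x, h.lor_self,
      h.lor_self_normal, h.lor_normal]
    linear_combination -hcs
  · have hsq := sq_mul_zero_le h.lor_normal
    rw [h.lor_self, h.lor_self_normal] at hsq
    have hyx : |y 0| < x 0 := abs_lt_of_sq_lt_sq (by nlinarith) hx.2.le
    have hsinh : |Real.sinh δ| < Real.cosh δ :=
      abs_lt_of_sq_lt_sq (by linarith) (Real.cosh_pos δ).le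
    have hlt : |Real.sinh δ * y 0| < Real.cosh δ * x 0 := by
      rw [abs_mul]
      exact mul_lt_mul'' hsinh hyx (abs_nonneg _) (abs_nonneg _)
    change 0 < Real.cosh δ * x 0 + Real.sinh δ * y 0
    linarith [(abs_lt.1 hlt).1]

variable {M : Type*} [TopologicalSpace M] [ChartedSpace (EuclideanSpace ℝ (Fin 2)) M]
  {f ν : M → R41} {p : M} {ε δ a b : ℝ}

/-- The relation `2ε(H - 1) + (1 - ε)K = 0` for `f` says that `ν_δ` has mean curvature one, where
`exp (2δ) = -ε`. -/
lemma IsWeingartenNormal.mixedAreaZero_sinh_cosh {U : Set M} (hε : ε < 0)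
    (h : IsWeingartenNormal ε f ν U) (hp : p ∈ U) :
    MixedAreaZero f ν 1 1 (Real.sinh (Real.log (-ε) / 2)) (Real.cosh (Real.log (-ε) / 2)) p := by
  set δ := Real.log (-ε) / 2
  have hexp : Real.exp δ = Real.exp (-δ) * -ε := by
    rw [← Real.exp_log (neg_pos.2 hε), ← Real.exp_add]
    congr 1
    ring
  have hsinh : Real.sinh δ = Real.exp (-δ) / 2 * -(1 + ε) := by rw [Real.sinh_eq, hexp]; ring
  have hcosh : Real.cosh δ = Real.exp (-δ) / 2 * (1 - ε) := by rw [Real.cosh_eq, hexp]; ring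
  refine h.mixedAreaZero_of_proportional hp (h.mixedAreaZero p hp) (Real.exp (-δ) / 2) ?_ ?_ ?_ <;>
    simp only [hsinh, hcosh] <;> ring

namespace LegendrianOn

lemma inEquidistant_of_par_eq [Nonempty M] (h : LegendrianOn f ν Set.univ)
    (hconst : ∀ x y, par δ ν f x = par δ ν f y) : InEquidistant f := by
  obtain ⟨p⟩ := ‹Nonempty M›
  rw [par_normal_eq_comb] at hconst
  refine ⟨comb (Real.sinh δ) (Real.cosh δ) f ν p, ?_, -Real.sinh δ, fun q => ?_⟩
  · rw [h.lor_comb (Set.mem_univ p)]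
    linarith [Real.cosh_sq δ]
  · have := h.lor_comb (Set.mem_univ q) 1 0 (Real.sinh δ) (Real.cosh δ)
    rw [comb_one_zero, hconst q p] at this
    linarith

lemma inHorosphere_of_add_eq [Nonempty M] (h : LegendrianOn f ν Set.univ)
    (hconst : ∀ x y, comb 1 1 f ν x = comb 1 1 f ν y) : InHorosphere f := by
  obtain ⟨p⟩ := ‹Nonempty M›
  have hf (q : M) : lor (f q) (comb 1 1 f ν p) = -1 := by
    have := h.lor_comb (Set.mem_univ q) 1 0 1 1
    rw [comb_one_zero, hconst q p] at this
    linarith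
  refine ⟨comb 1 1 f ν p, fun h0 => ?_, by rw [h.lor_comb (Set.mem_univ p)]; ring, -1, hf⟩
  have := hf p
  rw [h0, lor_comm, lor_zero_left] at this
  linarith

lemma mixedAreaZero_add_of_ne {U : Set M} {δ' : ℝ} (h : LegendrianOn f ν U) (hp : p ∈ U)
    (hδ : δ ≠ δ') (hmix : MixedAreaZero f ν 1 1 (Real.sinh δ) (Real.cosh δ) p)
    (hmix' : MixedAreaZero f ν 1 1 (Real.sinh δ') (Real.cosh δ') p) :
    MixedAreaZero f ν 1 1 1 1 p := by
  have hne : Real.sinh (δ - δ') ≠ 0 := by rwa [Ne, Real.sinh_eq_zero, sub_eq_zero]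
  refine (h.mixedAreaZero_iff hp).2 fun v w => mul_left_cancel₀ hne ?_
  have hvw := (h.mixedAreaZero_iff hp).1 hmix v w
  have hvw' := (h.mixedAreaZero_iff hp).1 hmix' v w
  rw [Real.sinh_sub]
  linear_combination (Real.cosh δ' - Real.sinh δ') * hvw - (Real.cosh δ - Real.sinh δ) * hvw'

variable [IsManifold (𝓡 2) ∞ M] [ConnectedSpace M]

lemma comb_eq_of_eventually_diff_eq_zero (h : LegendrianOn f ν Set.univ)
    (hpair : PairImmersionOn f ν Set.univ) (hab : a ≠ b) (hmix : ∀ q, MixedAreaZero f ν 1 1 a b q)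
    (h0 : ∀ᶠ q in 𝓝 p, diff (comb a b f ν) q = 0) (x y : M) :
    comb a b f ν x = comb a b f ν y := by
  have hopen : IsOpen {q | ∀ᶠ x in 𝓝 q, diff (comb a b f ν) x = 0} :=
    isOpen_iff_mem_nhds.2 fun q hq => eventually_eventually_nhds.2 hq
  have hclosed : IsClosed {q | ∀ᶠ x in 𝓝 q, diff (comb a b f ν) x = 0} := by
    refine isClosed_iff_frequently.2 fun q hq => by_contra fun hqS => hqS ?_
    refine h.eventually_diff_comb_eq_zero hpair hab (fun q _ => hmix q) (Set.mem_univ q) <|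
      frequently_nhdsWithin_iff.2 <| hq.mono fun x hx =>
        ⟨fun hreg => hreg.diff_ne_zero hx.self_of_nhds, fun hxq => hqS (hxq ▸ hx)⟩
  have huniv := IsClopen.eq_univ ⟨hclosed, hopen⟩ ⟨p, h0⟩
  exact eq_of_diff_eq_zero (contMDiffOn_univ.1 (h.smooth_comb a b))
    (fun q => (huniv.symm.subset (Set.mem_univ q)).self_of_nhds) x y

lemma eventually_isRegularPt_par (h : LegendrianOn f ν Set.univ)
    (hpair : PairImmersionOn f ν Set.univ) (hne : ¬ InEquidistant f)
    (hmix : ∀ q, MixedAreaZero f ν 1 1 (Real.sinh δ) (Real.cosh δ) q) (p : M) :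
    ∀ᶠ q in 𝓝[≠] p, IsRegularPt (par δ ν f) q := by
  rw [par_normal_eq_comb]
  by_contra hsing
  have h0 := h.eventually_diff_comb_eq_zero hpair (Real.sinh_lt_cosh δ).ne (fun q _ => hmix q)
    (Set.mem_univ p) (Filter.not_eventually.1 hsing)
  refine hne (h.inEquidistant_of_par_eq (δ := δ) ?_)
  rw [par_normal_eq_comb]
  exact h.comb_eq_of_eventually_diff_eq_zero hpair (Real.sinh_lt_cosh δ).ne hmix h0

lemma consistsOfIsolatedPoints_singularSet (h : LegendrianOn f ν Set.univ)
    (hpair : PairImmersionOn f ν Set.univ) (hne : ¬ InEquidistant f)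
    (hmix : ∀ q, MixedAreaZero f ν 1 1 (Real.sinh δ) (Real.cosh δ) q) :
    ConsistsOfIsolatedPoints (singularSet (par δ ν f)) := fun p _ =>
  (h.eventually_isRegularPt_par hpair hne hmix p).mono fun _ hq => not_not.2 hq

theorem isCMC1FrontS31 (h : LegendrianOn f ν Set.univ) (hf : ∀ p, f p ∈ H3)
    (hpair : PairImmersionOn f ν Set.univ) (hne : ¬ InEquidistant f)
    (hmix : ∀ q, MixedAreaZero f ν 1 1 (Real.sinh δ) (Real.cosh δ) q) :
    IsCMC1FrontS31 (par δ ν f) (par δ f ν) := by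
  have hcs := Real.cosh_sq_sub_sinh_sq δ
  have hlt := Real.sinh_lt_cosh δ
  have hreg : ∃ p, IsRegularPt (par δ ν f) p := by
    by_contra! hsing
    refine hne (h.inEquidistant_of_par_eq (δ := δ) ?_)
    rw [par_normal_eq_comb] at hsing ⊢
    obtain ⟨p⟩ : Nonempty M := inferInstance
    exact h.comb_eq_of_eventually_diff_eq_zero hpair hlt.ne hmix (p := p) <| .of_forall fun q =>
      h.diff_comb_eq_zero_of_not_isRegularPt hpair hlt.ne (Set.mem_univ q) (hmix q) (hsing q)
  rw [par_normal_eq_comb] at hreg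
  rw [par_normal_eq_comb, par_eq_comb]
  refine ⟨contMDiffOn_univ.1 (h.smooth_comb _ _), fun p => ?_, ⟨h.smooth_comb _ _, fun p hp =>
    ⟨smul_add_smul_mem_H3 (hf p) (h.normalFrame p hp) δ, ?_, fun v => ?_⟩⟩, fun p hp v hν hf => ?_,
    hreg, fun p hp => ?_⟩
  · change lor _ _ = 1
    rw [h.lor_comb (Set.mem_univ p)]
    linarith
  · rw [h.lor_comb hp]
    ring
  · obtain ⟨hvf, hvν⟩ := h.diff_comb_mem_tangentPlane hp (Real.sinh δ) (Real.cosh δ) v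
    simp only [comb, lor_add_right, lor_smul_right, hvf, hvν, mul_zero, add_zero]
  · exact h.eq_zero_of_diff_comb hp (hpair p hp) (by nlinarith) hν hf
  · rw [← par_normal_eq_comb] at hp ⊢
    exact (h.meanCurv_par_eq_one_iff (Set.mem_univ p) hp).2 (hmix p)

/-- Two such relations make the Gauss map `f + ν` singular, hence constant. -/
theorem eq_of_isCMC1FrontS31 {δ' : ℝ} (h : LegendrianOn f ν Set.univ)
    (hpair : PairImmersionOn f ν Set.univ) (hne : ¬ InHorosphere f)
    (hmix : ∀ q, MixedAreaZero f ν 1 1 (Real.sinh δ) (Real.cosh δ) q)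
    (hcmc : IsCMC1FrontS31 (par δ' ν f) (par δ' f ν)) : δ' = δ := by
  by_contra hδ
  obtain ⟨-, -, -, -, ⟨p, hp⟩, hH⟩ := hcmc
  have hgauss (q : M) (hq : IsRegularPt (par δ' ν f) q) : diff (comb 1 1 f ν) q = 0 := by
    have hq' := (h.meanCurv_par_eq_one_iff (Set.mem_univ q) hq).1 (hH q hq)
    refine h.diff_comb_eq_zero_of_singular (Set.mem_univ q) (hpair q (Set.mem_univ q))
      (by linarith [Real.sinh_lt_cosh δ]) (hmix q) ?_
    rw [h.not_isRegularPt_comb_iff (Set.mem_univ q)]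
    exact h.mixedAreaZero_add_of_ne (Set.mem_univ q) hδ hq' (hmix q)
  have hreg (q : M) (hq : diff (comb 1 1 f ν) q = 0) : IsRegularPt (par δ' ν f) q := by
    rw [par_normal_eq_comb]
    exact (injective_iff_map_eq_zero _).2 fun v hv =>
      h.eq_zero_of_diff_comb (Set.mem_univ q) (hpair q (Set.mem_univ q)) (a := 1) (b := 1)
        (by linarith [Real.sinh_lt_cosh δ']) (by rw [hq]; rfl) hv
  have hopen : IsOpen {q | diff (comb 1 1 f ν) q = 0} := isOpen_iff_mem_nhds.2 fun q hq => by
    have := h.eventually_isRegularPt_comb (Set.mem_univ q) (par_normal_eq_comb δ' f ν ▸ hreg q hq)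
    rw [← par_normal_eq_comb] at this
    exact this.mono hgauss
  have hclosed : IsClosed {q | diff (comb 1 1 f ν) q = 0} :=
    isClosed_iff_frequently.2 fun q hq => h.diff_comb_eq_zero_of_frequently (Set.mem_univ q) hq
  have huniv := IsClopen.eq_univ ⟨hclosed, hopen⟩ ⟨p, hgauss p hp⟩
  exact hne <| h.inHorosphere_of_add_eq <| eq_of_diff_eq_zero
    (contMDiffOn_univ.1 (h.smooth_comb 1 1)) fun q => huniv.symm.subset (Set.mem_univ q)

end LegendrianOn

end cmc

end

end HypFront

theorem corollary3p2_general {M : Type*} [TopologicalSpace M] [ConnectedSpace M]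
    [ChartedSpace (EuclideanSpace ℝ (Fin 2)) M] [IsManifold (𝓡 2) ∞ M]
    (ε : ℝ) (hε : ε < 0) (f : M → R41) (hf : f ∈ W M ε) (hne : ¬ InEquidistant f) :
    (∃ ν : M → R41, IsUnitNormalOn S31 f ν Set.univ ∧ SatisfiesLW ε f ν Set.univ) ∧
    ∀ ν : M → R41, IsUnitNormalOn S31 f ν Set.univ → SatisfiesLW ε f ν Set.univ →
      IsCMC1FrontS31 (par (Real.log (-ε) / 2) ν f) (par (Real.log (-ε) / 2) f ν) ∧
      ConsistsOfIsolatedPoints (singularSet (par (Real.log (-ε) / 2) ν f)) ∧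
      (¬ InHorosphere f → ∀ δ : ℝ, IsCMC1FrontS31 (par δ ν f) (par δ f ν) →
        δ = Real.log (-ε) / 2) := by
  have hfront := hf.1.1
  have hdense := dense_isRegularPt hε.ne hf
  refine ⟨?_, fun ν hν hLW => ?_⟩
  · obtain ⟨ν, hν⟩ := exists_global_isWeingartenNormal hε hf hne
    exact ⟨ν, hν.isUnitNormalOn, fun p hp hreg =>
      (hν.weingarten_iff hp hreg ε).2 (hν.mixedAreaZero p hp)⟩
  have hleg := hfront.legendrianOn isOpen_univ hν
  have hwein := hleg.isWeingartenNormal hf.1 hdense fun p hp hreg =>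
    (hleg.weingarten_iff hp hreg ε).1 (hLW p hp hreg)
  have hmix p := hwein.mixedAreaZero_sinh_cosh hε (Set.mem_univ p)
  have hpair := hwein.pairImmersion
  exact ⟨hleg.isCMC1FrontS31 hfront.2.1 hpair hne hmix,
    hleg.consistsOfIsolatedPoints_singularSet hpair hne hmix,
    fun hhor _ => hleg.eq_of_isCMC1FrontS31 hpair hhor hmix⟩

theorem corollary3p2 {M : Type*} [TopologicalSpace M] [T2Space M] [SecondCountableTopology M]
    [ConnectedSpace M] [ChartedSpace (EuclideanSpace ℝ (Fin 2)) M] [IsManifold (𝓡 2) ∞ M]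
    (ε : ℝ) (hε : ε < 0) (f : M → R41) (hf : f ∈ W M ε) (hne : ¬ InEquidistant f) :
    (∃ ν : M → R41, IsUnitNormalOn S31 f ν Set.univ ∧ SatisfiesLW ε f ν Set.univ) ∧
    ∀ ν : M → R41, IsUnitNormalOn S31 f ν Set.univ → SatisfiesLW ε f ν Set.univ →
      (∃ δ : ℝ, IsCMC1FrontS31 (par δ ν f) (par δ f ν) ∧
        ConsistsOfIsolatedPoints (singularSet (par δ ν f))) ∧
      (¬ InHorosphere f → ∃! δ : ℝ, IsCMC1FrontS31 (par δ ν f) (par δ f ν)) := by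
  obtain ⟨hnormal, h⟩ := corollary3p2_general ε hε f hf hne
  refine ⟨hnormal, fun ν hν hLW => ?_⟩
  obtain ⟨hcmc, hisolated, hunique⟩ := h ν hν hLW
  exact ⟨⟨_, hcmc, hisolated⟩, fun hhor => ⟨_, hcmc, hunique hhor⟩⟩
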